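/- Let $p:[0,\infty)\to[0,\infty)$ be non-decreasing and convex, and put $p^*(x)=\sup_{s\ge 0}[xs-p(s)]\in(-\infty,+\infty]$ (with $e^{+\infty}=+\infty$). For a function $\sigma:\mathbb R\to\mathbb R$ of bounded variation let $d\sigma$ be its finite signed Lebesgue--Stieltjes measure on $\mathbb R$, $|d\sigma|$ the total variation measure of $d\sigma$, and $$M_\sigma(x)=\int_{(-\infty,0]}e^{x\sqrt{|\lambda|}}\,|d\sigma(\lambda)|,\quad x\ge 0,\qquad (\mathfrak C\sigma)(x)=\int_{-\infty}^{\infty}\cos(x\sqrt\lambda)\,d\sigma(\lambda),\quad x\in\mathbb R,$$ where $\cos(x\sqrt\lambda)=\cosh(x\sqrt{-\lambda})$ for $\lambda<0$. (1) Suppose $\int_1^\infty p(s)s^{-3}\,ds=\infty$. If $\sigma$ has bounded variation, there is a constant $C>0$ with $M_\sigma(x)\le C\exp(p^*(x))$ for all $x\ge 0$ (the right-hand side is then finite for every $x$, so that $\mathfrak C\sigma$ is well defined), and $(\mathfrak C\sigma)(x)=0$ for all $x\in\mathbb R$, then $\sigma$ is constant up to its values at points where it is discontinuous from both sides: there is $c\in\mathbb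 R$ with $\sigma(\lambda)=c$ at every $\lambda$ at which $\sigma$ is right-continuous or left-continuous. In particular, if $\sigma$ is right-continuous at every point, then $\sigma\equiv c$. (2) If $\int_1^\infty p(s)s^{-3}\,ds<\infty$, there exist a right-continuous function $\sigma$ of bounded variation which is not constant and a constant $C>0$ such that $M_\sigma(x)<\infty$ and $M_\sigma(x)\le C\exp(p^*(x))$ for all $x\ge 0$, and $(\mathfrak C\sigma)(x)=0$ for all $x\in\mathbb R$. -/

import Mathlib

open MeasureTheory Set
open scoped ENNReal

namespace Vul

/-- The value of `cos (x √l)`, meaning `cosh (x √(-l))` for `l < 0`. -/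
noncomputable def cosSqrt (x l : ℝ) : ℝ :=
  if 0 ≤ l then Real.cos (x * √l) else Real.cosh (x * √(-l))

/-- The function `M_σ(x) = ∫_{(-∞, 0]} exp (x √|l|) |dσ(l)|` with values in `[0, ∞]`, where `dσ` is
the finite signed Lebesgue-Stieltjes measure of `σ` and `|dσ|` is its total variation measure. -/
noncomputable def growth {σ : ℝ → ℝ} (hσ : BoundedVariationOn σ univ) (x : ℝ) : ℝ≥0∞ :=
  ∫⁻ l in Iic (0 : ℝ), ENNReal.ofReal (Real.exp (x * √|l|)) ∂hσ.vectorMeasure.variation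

/-- The cosine transform `x ↦ ∫ cos (x √l) dσ(l)`. -/
noncomputable def cosTransform {σ : ℝ → ℝ} (hσ : BoundedVariationOn σ univ) (x : ℝ) : ℝ :=
  ∫ᵛ l, cosSqrt x l ∂•hσ.vectorMeasure

/-- The conjugate `p*(x) = sup_{s ≥ 0} (x s - p s)`, possibly `+∞`. -/
noncomputable def conjugate (p : ℝ → ℝ) (x : ℝ) : EReal :=
  ⨆ s ∈ Ici (0 : ℝ), ((x * s - p s : ℝ) : EReal)

/-- There is a constant `C` with `M_σ(x) ≤ C exp (p*(x))` for all `x ≥ 0`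
(here `exp (+∞) = +∞`). -/
def Majorized (p : ℝ → ℝ) {σ : ℝ → ℝ} (hσ : BoundedVariationOn σ univ) : Prop :=
  ∃ C : ℝ, 0 < C ∧ ∀ x : ℝ, 0 ≤ x →
    growth hσ x ≤ ENNReal.ofReal C * (conjugate p x).exp

/-- The integral `∫_1^∞ p(s) / s³ ds` of a non-negative function, with values in `[0, ∞]`. -/
noncomputable def vulIntegral (p : ℝ → ℝ) : ℝ≥0∞ :=
  ∫⁻ s in Ioi (1 : ℝ), ENNReal.ofReal (p s / s ^ 3)

end Vul

namespace Vul

open Complex Metric Real in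
/-- The Jensen inequality. -/
theorem log_norm_le_circleAverage {f : ℂ → ℂ} {B : ℂ → ℝ} {r : ℝ} (hr : 0 < r)
    (hf : AnalyticOnNhd ℂ f (closedBall 0 r)) (hf0 : f 0 ≠ 0)
    (hB : CircleIntegrable B 0 r) (hfB : ∀ z ∈ sphere (0 : ℂ) r, ‖f z‖ ≤ Real.exp (B z)) :
    Real.log ‖f 0‖ ≤ circleAverage B 0 r := by
  have hr' : |r| = r := abs_of_pos hr
  have hf' : AnalyticOnNhd ℂ f (closedBall 0 |r|) := by rwa [hr']
  have jensen := hf'.circleAverage_log_norm hr.ne' hf0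
  have hsum : 0 ≤ ∑ᶠ u, (MeromorphicOn.divisor f (closedBall 0 |r|) u : ℝ) *
      Real.log (r * ‖0 - u‖⁻¹) := by
    refine finsum_nonneg fun u => ?_
    have h1 : 0 ≤ MeromorphicOn.divisor f (closedBall 0 |r|) u := by
      have := MeromorphicOn.AnalyticOnNhd.divisor_nonneg hf'
      exact this u
    by_cases hu : u ∈ closedBall (0 : ℂ) |r|
    · refine mul_nonneg (by exact_mod_cast h1) ?_
      rcases eq_or_ne u 0 with rfl | hu0
      · simp
      · apply Real.log_nonneg
        have h2 : 0 < ‖u‖ := norm_pos_iff.2 hu0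
        rw [zero_sub, norm_neg, ← div_eq_mul_inv, le_div_iff₀ h2]
        simpa [hr'] using hu
    · have : MeromorphicOn.divisor f (closedBall 0 |r|) u = 0 :=
        Function.locallyFinsuppWithin.apply_eq_zero_of_notMem _ hu
      simp [this]
  classical
  set u : ℂ → ℝ := fun z => if f z = 0 then B z else Real.log ‖f z‖ with hu
  have hcod : (fun z => Real.log ‖f z‖) =ᶠ[Filter.codiscreteWithin (sphere (0 : ℂ) |r|)] u := by
    have h0 : f ⁻¹' {0}ᶜ ∈ Filter.codiscreteWithin (closedBall (0 : ℂ) |r|) :=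
      hf'.preimage_zero_mem_codiscreteWithin hf0 (by simp)
        ⟨⟨0, by simp⟩, (convex_closedBall _ _).isPreconnected⟩
    filter_upwards [Filter.codiscreteWithin_mono sphere_subset_closedBall h0] with z hz
    have : f z ≠ 0 := hz
    simp [hu, this]
  have hint : CircleIntegrable (fun z => Real.log ‖f z‖) 0 r :=
    (hf'.mono sphere_subset_closedBall).meromorphicOn.circleIntegrable_log_norm
  have huint : CircleIntegrable u 0 r := hint.congr_codiscreteWithin hcod
  have h1 : circleAverage (fun z => Real.log ‖f z‖) 0 r = circleAverage u 0 r :=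
    circleAverage_congr_codiscreteWithin hcod hr.ne'
  have h2 : circleAverage u 0 r ≤ circleAverage B 0 r := by
    refine circleAverage_mono huint hB fun z hz => ?_
    rw [hr'] at hz
    simp only [hu]
    split_ifs with h
    · rfl
    · rw [Real.log_le_iff_le_exp (norm_pos_iff.2 h)]
      exact hfB z hz
  have h3 : circleAverage (fun z => Real.log ‖f z‖) 0 r = _ := jensen
  linarith

/-- A change of variables together with a reduction to large arguments. -/
theorem vulIntegral_lt_top_of_lintegral {p : ℝ → ℝ} (hp_nonneg : ∀ s, 0 ≤ s → 0 ≤ p s)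
    (hp_mono : MonotoneOn p (Ici 0)) {c d : ℝ} (hc : 0 < c) (hd : 0 < d)
    (h : ∫⁻ θ in Ioo 0 d, ENNReal.ofReal (p (√(c / θ))) < ⊤) : vulIntegral p < ⊤ := by
  obtain ⟨s₀, hs₀, hs₀d⟩ : ∃ s₀ : ℝ, 1 < s₀ ∧ c / s₀ ^ 2 < d := by
    refine ⟨max 2 (c / d + 1), by simp, ?_⟩
    set s := max 2 (c / d + 1)
    have h1 : c / d + 1 ≤ s := le_max_right _ _
    have h2 : 2 ≤ s := le_max_left _ _
    have h3 : c / d < s ^ 2 := by nlinarith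
    rw [div_lt_iff₀ (by positivity)]
    rw [div_lt_iff₀ hd] at h3
    linarith
  have hs0 : 0 < s₀ := by linarith
  have hsplit : Ioi (1 : ℝ) = Ioc 1 s₀ ∪ Ioi s₀ := (Ioc_union_Ioi_eq_Ioi hs₀.le).symm
  rw [vulIntegral, hsplit]
  refine (lintegral_union_le _ _ _).trans_lt (ENNReal.add_lt_top.2 ⟨?_, ?_⟩)
  · calc ∫⁻ s in Ioc 1 s₀, ENNReal.ofReal (p s / s ^ 3)
        ≤ ∫⁻ s in Ioc 1 s₀, ENNReal.ofReal (p s₀) := by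
          refine setLIntegral_mono measurable_const fun s hs => ENNReal.ofReal_le_ofReal ?_
          have h1 : (1 : ℝ) ≤ s ^ 3 := one_le_pow₀ hs.1.le
          have h2 : p s ≤ p s₀ := hp_mono (by simp; linarith [hs.1]) (by simp; linarith) hs.2
          have h3 := hp_nonneg s (by linarith [hs.1])
          exact (div_le_self h3 h1).trans h2
      _ < ⊤ := by
          rw [setLIntegral_const]
          exact ENNReal.mul_lt_top ENNReal.ofReal_lt_top measure_Ioc_lt_top
  · have himg : (fun s : ℝ => c / s ^ 2) '' Ioi s₀ ⊆ Ioo 0 d := by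
      rintro _ ⟨s, hs, rfl⟩
      have hs' : s₀ < s := hs
      refine ⟨by have : 0 < s := hs0.trans hs'; positivity, lt_of_le_of_lt ?_ hs₀d⟩
      change c / s ^ 2 ≤ c / s₀ ^ 2
      gcongr
    have hcv := lintegral_image_eq_lintegral_abs_deriv_mul (s := Ioi s₀)
      (f := fun s : ℝ => c / s ^ 2) (f' := fun s => -(2 * c / s ^ 3)) measurableSet_Ioi
      (fun s hs => by
        have hs' : 0 < s := hs0.trans hs
        have := ((hasDerivAt_pow 2 s).inv (by positivity)).const_mul c
        refine HasDerivAt.hasDerivWithinAt ?_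
        simp only [div_eq_mul_inv c]
        convert! this using 1
        field_simp
        norm_num)
      (fun x hx y hy hxy => by
        have hx' : 0 < x := hs0.trans hx
        have hy' : 0 < y := hs0.trans hy
        simp only at hxy
        rw [div_eq_div_iff (by positivity) (by positivity)] at hxy
        have h3 : y ^ 2 = x ^ 2 := mul_left_cancel₀ hc.ne' hxy
        exact ((pow_left_inj₀ hy'.le hx'.le two_ne_zero).1 h3).symm)
      (fun θ => ENNReal.ofReal (p (√(c / θ))))
    have hfin : ∫⁻ s in Ioi s₀, ENNReal.ofReal |-(2 * c / s ^ 3)| *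
        ENNReal.ofReal (p (√(c / (c / s ^ 2)))) < ⊤ := by
      rw [← hcv]
      exact (lintegral_mono_set himg).trans_lt h
    have heq : ∫⁻ s in Ioi s₀, ENNReal.ofReal |-(2 * c / s ^ 3)| *
        ENNReal.ofReal (p (√(c / (c / s ^ 2)))) =
        ∫⁻ s in Ioi s₀, ENNReal.ofReal (2 * c) * ENNReal.ofReal (p s / s ^ 3) := by
      refine setLIntegral_congr_fun measurableSet_Ioi fun s hs => ?_
      have hs' : 0 < s := hs0.trans hs
      have h1 : c / (c / s ^ 2) = s ^ 2 := by field_simp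
      simp only [h1, Real.sqrt_sq hs'.le, abs_neg]
      rw [abs_of_pos (by positivity), ← ENNReal.ofReal_mul (by positivity),
        ← ENNReal.ofReal_mul (by positivity)]
      congr 1
      ring
    rw [heq, lintegral_const_mul' _ _ ENNReal.ofReal_ne_top] at hfin
    exact ENNReal.lt_top_of_mul_ne_top_right hfin.ne (by simpa using hc)

/-- On the arc `1 - r ≤ θ ≤ d`, the image of the circle of radius `r` under `ζ ↦ a + I b / (1 - ζ)`
is far to the left. -/
theorem arc_bound {a b r θ : ℝ} (hb : 0 < b) (hr : 1 / 2 ≤ r) (hr1 : r < 1)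
    (hθ : 1 - r ≤ θ) (hθ1 : θ ≤ 1) (hθa : θ * (16 * |a|) ≤ b) :
    b / (16 * θ) ≤ b * (circleMap 0 r θ).im / ‖1 - circleMap 0 r θ‖ ^ 2 - a := by
  have hθ0 : 0 < θ := by linarith
  have him : (circleMap 0 r θ).im = r * Real.sin θ := by
    simp [circleMap, Complex.exp_im]
  have hre : (circleMap 0 r θ).re = r * Real.cos θ := by
    simp [circleMap, Complex.exp_re]
  have hnorm : ‖1 - circleMap 0 r θ‖ ^ 2 = (1 - r) ^ 2 + 2 * r * (1 - Real.cos θ) := by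
    rw [← Complex.normSq_eq_norm_sq, Complex.normSq_apply]
    simp only [Complex.sub_re, Complex.sub_im, Complex.one_re, Complex.one_im, him, hre]
    nlinarith [Real.sin_sq_add_cos_sq θ]
  have hcos : 1 - Real.cos θ ≤ θ ^ 2 / 2 := by linarith [Real.one_sub_sq_div_two_le_cos (x := θ)]
  have hcos' : 0 ≤ 1 - Real.cos θ := by linarith [Real.cos_le_one θ]
  have hle : ‖1 - circleMap 0 r θ‖ ^ 2 ≤ 2 * θ ^ 2 := by
    rw [hnorm]
    nlinarith
  have hpos : 0 < ‖1 - circleMap 0 r θ‖ ^ 2 := by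
    rw [hnorm]
    nlinarith
  have hsin : θ / 2 ≤ Real.sin θ := by
    have h2 := Real.sin_gt_sub_cube hθ0
    have h3 : θ ^ 3 ≤ θ := pow_le_of_le_one hθ0.le hθ1 three_ne_zero
    linarith
  have h1 : b / (8 * θ) ≤ b * (circleMap 0 r θ).im / ‖1 - circleMap 0 r θ‖ ^ 2 := by
    rw [div_le_div_iff₀ (by positivity) hpos, him]
    have h3 : θ / 4 ≤ r * Real.sin θ := by nlinarith
    have h4 : b * (2 * θ ^ 2) ≤ b * (r * Real.sin θ) * (8 * θ) := by
      have h5 := mul_le_mul_of_nonneg_left h3 (by positivity : 0 ≤ b * 8 * θ)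
      nlinarith
    have h6 := mul_le_mul_of_nonneg_left hle hb.le
    linarith
  have h2 : a ≤ b / (16 * θ) := by
    rw [le_div_iff₀ (by positivity)]
    nlinarith [le_abs_self a]
  have h3 : b / (8 * θ) = 2 * (b / (16 * θ)) := by field_simp; norm_num
  linarith

open Complex Metric in
/-- A function that is holomorphic in the upper half-plane and decays, along its left half, at a
rate with divergent logarithmic integral vanishes. -/
theorem eq_zero_of_decay {p : ℝ → ℝ} (hp_nonneg : ∀ s, 0 ≤ s → 0 ≤ p s)
    (hp_mono : MonotoneOn p (Ici 0)) (hp : vulIntegral p = ⊤) {g : ℂ → ℂ}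
    (hg : DifferentiableOn ℂ g {w | 0 < w.im}) {C : ℝ} (hC : 0 < C)
    (hgC : ∀ w : ℂ, 0 < w.im → ‖g w‖ ≤ C * Real.exp (-p (√((‖w‖ - w.re) / 2))) / w.im)
    (w₀ : ℂ) (hw₀ : 0 < w₀.im) : g w₀ = 0 := by
  by_contra hne
  refine (vulIntegral_lt_top_of_lintegral (c := w₀.im / 16) (d := min 1 (w₀.im / (16 * |w₀.re| + 1)))
    hp_nonneg hp_mono (by positivity) (by positivity) ?_).ne hp
  set a := w₀.re
  set b := w₀.im
  set d := min 1 (b / (16 * |a| + 1)) with hd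
  have hd1 : d ≤ 1 := min_le_left _ _
  have hda : d * (16 * |a|) ≤ b := by
    have h1 : d ≤ b / (16 * |a| + 1) := min_le_right _ _
    rw [le_div_iff₀ (by positivity)] at h1
    have : 0 ≤ d := by positivity
    linarith
  have hd0 : 0 < d := by positivity
  set q : ℝ → ℝ := fun t => p (√t) with hq
  have hqm : Monotone q := fun x y hxy =>
    hp_mono (Real.sqrt_nonneg _) (Real.sqrt_nonneg _) (Real.sqrt_le_sqrt hxy)
  have hq0 : ∀ t, 0 ≤ q t := fun t => hp_nonneg _ (Real.sqrt_nonneg _)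
  set φ : ℂ → ℂ := fun ζ => a + I * b / (1 - ζ) with hφ
  have hne1 : ∀ ζ : ℂ, ‖ζ‖ < 1 → 1 - ζ ≠ 0 := by
    intro ζ hζ h
    rw [sub_eq_zero] at h
    rw [← h] at hζ
    simp at hζ
  have hφre : ∀ ζ, (φ ζ).re = a - b * ζ.im / ‖1 - ζ‖ ^ 2 := by
    intro ζ
    simp [hφ, Complex.div_re, ← Complex.normSq_eq_norm_sq]
    ring
  have hφim : ∀ ζ, (φ ζ).im = b * (1 - ζ.re) / ‖1 - ζ‖ ^ 2 := by
    intro ζ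
    simp [hφ, Complex.div_im, ← Complex.normSq_eq_norm_sq]
  have hφim' : ∀ ζ, ‖ζ‖ < 1 → b / 2 ≤ (φ ζ).im := by
    intro ζ hζ
    have h0 : 0 < ‖1 - ζ‖ ^ 2 := by
      have := norm_pos_iff.2 (hne1 ζ hζ)
      positivity
    rw [hφim, div_le_div_iff₀ (by norm_num) h0]
    have h1 : ‖1 - ζ‖ ^ 2 = (1 - ζ.re) ^ 2 + ζ.im ^ 2 := by
      rw [← Complex.normSq_eq_norm_sq, Complex.normSq_apply]
      simp
      ring
    have h2 : ζ.re ^ 2 + ζ.im ^ 2 < 1 := by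
      have h3 : ‖ζ‖ ^ 2 = ζ.re ^ 2 + ζ.im ^ 2 := by
        rw [← Complex.normSq_eq_norm_sq, Complex.normSq_apply]
        ring
      rw [← h3]
      have := norm_nonneg ζ
      nlinarith
    have h4 : ‖1 - ζ‖ ^ 2 ≤ (1 - ζ.re) * 2 := by rw [h1]; nlinarith
    have := mul_le_mul_of_nonneg_left h4 hw₀.le
    linarith
  have hφ0 : φ 0 = w₀ := by
    simp only [hφ, sub_zero, div_one, a, b]
    rw [mul_comm, Complex.re_add_im]
  set L := Real.log (2 * C / b) with hL
  set B : ℂ → ℝ := fun ζ => L - q ((‖φ ζ‖ - (φ ζ).re) / 2) with hB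
  set K := 2 * Real.pi * (L - Real.log ‖g w₀‖) with hK
  have hcont : ∀ r : ℝ, 0 < r → r < 1 →
      Continuous fun θ : ℝ => (‖φ (circleMap 0 r θ)‖ - (φ (circleMap 0 r θ)).re) / 2 := by
    intro r hr hr1
    have : Continuous fun θ : ℝ => φ (circleMap 0 r θ) := by
      refine continuous_const.add (continuous_const.div
        (continuous_const.sub (continuous_circleMap 0 r)) fun θ => hne1 _ ?_)
      simp [abs_of_pos hr, hr1]
    exact (this.norm.sub (continuous_re.comp this)).div_const 2
  have hqint : ∀ r : ℝ, 0 < r → r < 1 → IntervalIntegrable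
      (fun θ => q ((‖φ (circleMap 0 r θ)‖ - (φ (circleMap 0 r θ)).re) / 2)) volume 0
      (2 * Real.pi) := by
    intro r hr hr1
    obtain ⟨T, hT⟩ := (isCompact_Icc.image (hcont r hr hr1) :
      IsCompact (_ '' Icc (0 : ℝ) (2 * Real.pi))).bddAbove
    rw [intervalIntegrable_iff_integrableOn_Icc_of_le Real.two_pi_pos.le]
    refine IntegrableOn.of_bound measure_Icc_lt_top
      (hqm.measurable.comp (hcont r hr hr1).measurable).aestronglyMeasurable (q T) ?_
    filter_upwards [ae_restrict_mem measurableSet_Icc] with θ hθ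
    rw [Real.norm_of_nonneg (hq0 _)]
    exact hqm (hT ⟨θ, hθ, rfl⟩)
  have key : ∀ r : ℝ, 1 / 2 ≤ r → r < 1 →
      ∫⁻ θ in Ioo (1 - r) d, ENNReal.ofReal (p (√(b / 16 / θ))) ≤ ENNReal.ofReal K := by
    intro r hr hr1
    have hr0 : 0 < r := by linarith
    have hlt : ∀ ζ ∈ closedBall (0 : ℂ) r, ‖ζ‖ < 1 := fun ζ hζ => by
      have : ‖ζ‖ ≤ r := by simpa using hζ
      linarith
    have hopen : IsOpen {w : ℂ | 0 < w.im} := isOpen_lt continuous_const continuous_im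
    have hAn : AnalyticOnNhd ℂ (fun ζ => g (φ ζ)) (closedBall 0 r) := by
      intro ζ hζ
      have h1 : AnalyticAt ℂ g (φ ζ) :=
        hg.analyticAt (hopen.mem_nhds (lt_of_lt_of_le (by positivity) (hφim' ζ (hlt ζ hζ))))
      refine h1.comp (f := φ) ?_
      exact analyticAt_const.add (analyticAt_const.div (analyticAt_const.sub analyticAt_id)
        (hne1 ζ (hlt ζ hζ)))
    have hBint : CircleIntegrable B 0 r := by
      have : IntervalIntegrable (fun θ => L - q ((‖φ (circleMap 0 r θ)‖ -
        (φ (circleMap 0 r θ)).re) / 2)) volume 0 (2 * Real.pi) :=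
        intervalIntegrable_const.sub (hqint r hr0 hr1)
      exact this
    have hJ := log_norm_le_circleAverage (f := fun ζ => g (φ ζ)) (B := B) hr0 hAn
      (by simpa only [hφ0] using hne) hBint (fun ζ hζ => by
        have hζ1 := hlt ζ (sphere_subset_closedBall hζ)
        have h1 := hφim' ζ hζ1
        have h2 : 0 < (φ ζ).im := lt_of_lt_of_le (by positivity) h1
        refine (hgC _ h2).trans ?_
        rw [hB]
        simp only [hL]
        rw [sub_eq_add_neg (Real.log _), Real.exp_add, Real.exp_log (by positivity), div_le_iff₀ h2]
        have h3 : C ≤ 2 * C / b * (φ ζ).im := by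
          rw [div_mul_eq_mul_div, le_div_iff₀ hw₀]
          nlinarith
        have h4 := mul_le_mul_of_nonneg_right h3
          (Real.exp_pos (-q ((‖φ ζ‖ - (φ ζ).re) / 2))).le
        linarith)
    have hJ2 : ∫ θ in (0 : ℝ)..2 * Real.pi,
        q ((‖φ (circleMap 0 r θ)‖ - (φ (circleMap 0 r θ)).re) / 2) ≤ K := by
      rw [Real.circleAverage_def] at hJ
      simp only [hB, hφ0, smul_eq_mul] at hJ
      rw [intervalIntegral.integral_sub intervalIntegrable_const (hqint r hr0 hr1),
        intervalIntegral.integral_const, inv_mul_eq_div, le_div_iff₀ Real.two_pi_pos,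
        smul_eq_mul] at hJ
      rw [hK]
      linarith
    have hIoo : Ioo (1 - r) d ⊆ Ioc 0 (2 * Real.pi) := fun θ hθ =>
      ⟨by linarith [hθ.1], by linarith [hθ.2, Real.pi_gt_three]⟩
    calc ∫⁻ θ in Ioo (1 - r) d, ENNReal.ofReal (p (√(b / 16 / θ)))
        ≤ ∫⁻ θ in Ioo (1 - r) d, ENNReal.ofReal
          (q ((‖φ (circleMap 0 r θ)‖ - (φ (circleMap 0 r θ)).re) / 2)) := by
          refine setLIntegral_mono
            (hqm.measurable.comp (hcont r hr0 hr1).measurable).ennreal_ofReal fun θ hθ => ?_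
          refine ENNReal.ofReal_le_ofReal (hqm ?_)
          have h1 := arc_bound (a := a) hw₀ hr hr1 hθ.1.le (hθ.2.le.trans hd1)
            ((mul_le_mul_of_nonneg_right hθ.2.le (by positivity)).trans hda)
          have h2 : b / 16 / θ = b / (16 * θ) := by rw [div_div]
          have h3 := hφre (circleMap 0 r θ)
          have h4 := neg_abs_le (φ (circleMap 0 r θ)).re
          have h5 := Complex.abs_re_le_norm (φ (circleMap 0 r θ))
          linarith
      _ ≤ ∫⁻ θ in Ioc 0 (2 * Real.pi), ENNReal.ofReal
          (q ((‖φ (circleMap 0 r θ)‖ - (φ (circleMap 0 r θ)).re) / 2)) := lintegral_mono_set hIoo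
      _ = ENNReal.ofReal (∫ θ in Ioc 0 (2 * Real.pi),
          q ((‖φ (circleMap 0 r θ)‖ - (φ (circleMap 0 r θ)).re) / 2)) := by
          rw [ofReal_integral_eq_lintegral_ofReal]
          · exact (intervalIntegrable_iff_integrableOn_Ioc_of_le Real.two_pi_pos.le).1
              (hqint r hr0 hr1)
          · exact Filter.Eventually.of_forall fun θ => hq0 _
      _ ≤ ENNReal.ofReal K := by
          rw [← intervalIntegral.integral_of_le Real.two_pi_pos.le]
          exact ENNReal.ofReal_le_ofReal hJ2
  have hU : Ioo 0 d = ⋃ n : ℕ, Ioo (1 - (1 - 1 / ((n : ℝ) + 2))) d := by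
    ext θ
    simp only [mem_Ioo, mem_iUnion, sub_sub_cancel]
    constructor
    · rintro ⟨h1, h2⟩
      obtain ⟨n, hn⟩ := exists_nat_one_div_lt h1
      refine ⟨n, lt_of_le_of_lt ?_ hn, h2⟩
      gcongr
      norm_num
    · rintro ⟨n, h1, h2⟩
      exact ⟨lt_trans (by positivity) h1, h2⟩
  rw [hU, setLIntegral_iUnion_of_directed]
  · refine lt_of_le_of_lt (iSup_le fun n => key _ ?_ ?_) ENNReal.ofReal_lt_top
    · have : 1 / ((n : ℝ) + 2) ≤ 1 / 2 := by gcongr; linarith [(Nat.cast_nonneg n : (0 : ℝ) ≤ n)]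
      linarith
    · have : 0 < 1 / ((n : ℝ) + 2) := by positivity
      linarith
  · refine directed_of_isDirected_le fun m n hmn => Ioo_subset_Ioo_left ?_
    simp only [sub_sub_cancel]
    gcongr

theorem isFiniteMeasure_variation (m : SignedMeasure ℝ) : IsFiniteMeasure m.variation := by
  rw [← SignedMeasure.totalVariation_eq_variation, SignedMeasure.totalVariation]
  infer_instance

theorem integral_sub_toSignedMeasure (P N : Measure ℝ) [IsFiniteMeasure P] [IsFiniteMeasure N]
    {f : ℝ → ℝ} (hP : Integrable f P) (hN : Integrable f N) :
    ∫ᵛ l, f l ∂•(P.toSignedMeasure - N.toSignedMeasure) = ∫ l, f l ∂P - ∫ l, f l ∂N := by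
  have hflip : (ContinuousLinearMap.lsmul ℝ ℝ : ℝ →L[ℝ] ℝ →L[ℝ] ℝ).flip =
      ContinuousLinearMap.lsmul ℝ ℝ := by
    ext
    simp
  rw [VectorMeasure.integral_sub_vectorMeasure (by simpa [VectorMeasure.Integrable] using hP)
    (by simpa [VectorMeasure.Integrable] using hN), ← hflip]
  simp

/-- The polar decomposition of a signed measure. -/
theorem exists_sign (m : SignedMeasure ℝ) :
    ∃ h : ℝ → ℝ, Measurable h ∧ (∀ l, |h l| ≤ 1) ∧
      (∀ f : ℝ → ℝ, Integrable f m.variation →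
        ∫ᵛ l, f l ∂•m = ∫ l, f l * h l ∂m.variation) ∧
      ∀ s, MeasurableSet s → m s = ∫ l in s, h l ∂m.variation := by
  classical
  obtain ⟨S, hS, hSP, hSN⟩ := m.toJordanDecomposition.mutuallySingular
  set P := m.toJordanDecomposition.posPart
  set N := m.toJordanDecomposition.negPart
  have hm : m = P.toSignedMeasure - N.toSignedMeasure :=
    (SignedMeasure.toSignedMeasure_toJordanDecomposition m).symm
  have hV : m.variation = P + N := by
    rw [← SignedMeasure.totalVariation_eq_variation, SignedMeasure.totalVariation]
  set h : ℝ → ℝ := fun l => if l ∈ S then -1 else 1 with hh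
  have hhm : Measurable h := Measurable.ite hS measurable_const measurable_const
  have hh1 : ∀ l, |h l| ≤ 1 := fun l => by
    simp only [hh]
    split_ifs <;> simp
  have hP : ∀ᵐ l ∂P, h l = 1 := by
    have : ∀ᵐ l ∂P, l ∉ S := measure_eq_zero_iff_ae_notMem.1 hSP
    filter_upwards [this] with l hl
    simp [hh, hl]
  have hN : ∀ᵐ l ∂N, h l = -1 := by
    have : ∀ᵐ l ∂N, l ∉ Sᶜ := measure_eq_zero_iff_ae_notMem.1 hSN
    filter_upwards [this] with l hl
    simp only [mem_compl_iff, not_not] at hl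
    simp [hh, hl]
  have key : ∀ (f : ℝ → ℝ), Integrable f (P + N) →
      ∫ l, f l * h l ∂(P + N) = ∫ l, f l ∂P - ∫ l, f l ∂N := by
    intro f hf
    have hfh : Integrable (fun l => f l * h l) (P + N) :=
      hf.mul_bdd hhm.aestronglyMeasurable (Filter.Eventually.of_forall fun l => by
        simpa using hh1 l)
    rw [integral_add_measure hfh.left_of_add_measure hfh.right_of_add_measure]
    have h1 : ∫ l, f l * h l ∂P = ∫ l, f l ∂P :=
      integral_congr_ae (by filter_upwards [hP] with l hl; simp [hl])
    have h2 : ∫ l, f l * h l ∂N = ∫ l, -f l ∂N :=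
      integral_congr_ae (by filter_upwards [hN] with l hl; simp [hl])
    rw [h1, h2, integral_neg, sub_eq_add_neg]
  refine ⟨h, hhm, hh1, fun f hf => ?_, fun s hs => ?_⟩
  · rw [hV] at hf ⊢
    rw [key f hf, ← integral_sub_toSignedMeasure P N hf.left_of_add_measure
      hf.right_of_add_measure, ← hm]
  · rw [hV, ← integral_indicator hs]
    have h1 := key (s.indicator 1) ((integrable_const (1 : ℝ)).indicator hs)
    have h2 : ∀ l, s.indicator h l = s.indicator (1 : ℝ → ℝ) l * h l := fun l => by
      by_cases hl : l ∈ s <;> simp [hl]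
    simp only [h2]
    rw [h1, integral_indicator_one hs, integral_indicator_one hs]
    nth_rewrite 1 [hm]
    simp [hs]

/-- A complex square root of a real number. -/
noncomputable def root (l : ℝ) : ℂ := if 0 ≤ l then (√l : ℂ) else Complex.I * √(-l)

theorem root_sq (l : ℝ) : root l ^ 2 = l := by
  unfold root
  split_ifs with h
  · rw [← Complex.ofReal_pow, Real.sq_sqrt h]
  · rw [mul_pow, ← Complex.ofReal_pow, Real.sq_sqrt (by linarith)]
    simp

theorem cosSqrt_eq (x l : ℝ) : (cosSqrt x l : ℂ) = Complex.cos (x * root l) := by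
  unfold cosSqrt root
  split_ifs with h
  · simp
  · rw [mul_comm Complex.I, ← mul_assoc, Complex.cos_mul_I]
    simp

theorem measurable_cosSqrt : Measurable (Function.uncurry cosSqrt) := by
  unfold cosSqrt Function.uncurry
  refine Measurable.ite (measurableSet_le measurable_const measurable_snd) ?_ ?_
  · fun_prop
  · fun_prop

theorem abs_cosSqrt_le {t x l : ℝ} (ht : 0 ≤ t) (htx : t ≤ x) :
    |cosSqrt t l| ≤ 1 + (Iic (0 : ℝ)).indicator (fun l => Real.exp (x * √|l|)) l := by
  have h0 : 0 ≤ (Iic (0 : ℝ)).indicator (fun l => Real.exp (x * √|l|)) l :=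
    indicator_nonneg (fun _ _ => (Real.exp_pos _).le) l
  unfold cosSqrt
  split_ifs with h
  · linarith [Real.abs_cos_le_one (t * √l)]
  · push Not at h
    rw [indicator_of_mem (show l ∈ Iic (0 : ℝ) from h.le), abs_of_neg h, abs_of_pos (Real.cosh_pos _)]
    have h1 : t * √(-l) ≤ x * √(-l) := by gcongr
    have h2 : 0 ≤ t * √(-l) := by positivity
    rw [Real.cosh_eq]
    have h3 := Real.exp_le_exp.2 h1
    have h4 : Real.exp (-(t * √(-l))) ≤ 1 := Real.exp_le_one_iff.2 (by linarith)
    have h5 := Real.exp_pos (x * √(-l))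
    linarith

theorem integrable_cosSqrt {V : Measure ℝ} [IsFiniteMeasure V] {x : ℝ}
    (hx : Integrable ((Iic (0 : ℝ)).indicator fun l => Real.exp (x * √|l|)) V) {t : ℝ}
    (ht : 0 ≤ t) (htx : t ≤ x) : Integrable (fun l => cosSqrt t l) V := by
  refine ((integrable_const (1 : ℝ)).add hx).mono'
    (measurable_cosSqrt.comp (measurable_const.prodMk measurable_id)).aestronglyMeasurable ?_
  exact Filter.Eventually.of_forall fun l => abs_cosSqrt_le ht htx

open Complex in
/-- Variation of parameters. -/
theorem integral_sin_mul_cosSqrt {ω : ℂ} {l : ℝ} (hω : ω ≠ 0) (hl : ω ^ 2 ≠ l) (x : ℝ) :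
    ∫ t in (0 : ℝ)..x, sin ((x - t) * ω) / ω * cosSqrt t l =
      (cos (x * root l) - cos (x * ω)) / (ω ^ 2 - l) := by
  set k := root l
  have hk : k ^ 2 = l := root_sq l
  have hd : ω ^ 2 - k ^ 2 ≠ 0 := by rwa [hk, sub_ne_zero]
  have hderiv : ∀ t : ℝ, HasDerivAt (fun t : ℝ => (ω * cos ((x - t) * ω) * cos (t * k) -
      k * sin ((x - t) * ω) * sin (t * k)) / (ω * (ω ^ 2 - k ^ 2)))
      (sin ((x - t) * ω) / ω * cos (t * k)) t := by
    intro t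
    have h1 : HasDerivAt (fun z : ℂ => (x - z) * ω) (-ω) (t : ℂ) := by
      simpa using ((hasDerivAt_id (t : ℂ)).const_sub (x : ℂ)).mul_const ω
    have h2 : HasDerivAt (fun z : ℂ => z * k) k (t : ℂ) := by
      simpa using (hasDerivAt_id (t : ℂ)).mul_const k
    have h3 := (((h1.ccos.const_mul ω).mul h2.ccos).sub
      ((h1.csin.const_mul k).mul h2.csin)).div_const (ω * (ω ^ 2 - k ^ 2))
    have h4 := h3.comp_ofReal
    refine h4.congr_deriv ?_
    field_simp
    ring
  have hint : ∫ t in (0 : ℝ)..x, sin ((x - t) * ω) / ω * cos (t * k) = _ :=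
    intervalIntegral.integral_eq_sub_of_hasDerivAt (fun t _ => hderiv t)
      (Continuous.intervalIntegrable (by fun_prop) _ _)
  simp only [cosSqrt_eq]
  rw [hint, ← hk]
  simp
  field_simp

/-- The Cauchy transform of the measure with density `h` with respect to `V`. -/
noncomputable def cauchyTransform (V : Measure ℝ) (h : ℝ → ℝ) (w : ℂ) : ℂ :=
  ∫ l : ℝ, (h l : ℂ) / (l - w) ∂V

theorem im_le_norm_sub (l : ℝ) {w : ℂ} (hw : 0 < w.im) : w.im ≤ ‖(l : ℂ) - w‖ := by
  have := Complex.abs_im_le_norm ((l : ℂ) - w)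
  simp only [Complex.sub_im, Complex.ofReal_im, zero_sub, abs_neg, abs_of_pos hw] at this
  exact this

theorem sub_ne_zero_of_im_pos (l : ℝ) {w : ℂ} (hw : 0 < w.im) : (l : ℂ) - w ≠ 0 :=
  norm_pos_iff.1 (hw.trans_le (im_le_norm_sub l hw))

theorem integrable_cauchy {V : Measure ℝ} {f : ℝ → ℝ} (hf : Integrable f V) {w : ℂ} (hw : 0 < w.im) :
    Integrable (fun l : ℝ => (f l : ℂ) / (l - w)) V := by
  simp only [div_eq_mul_inv]
  refine hf.ofReal.mul_bdd (c := 1 / w.im)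
    ((Complex.measurable_ofReal.sub measurable_const).inv).aestronglyMeasurable ?_
  refine Filter.Eventually.of_forall fun l => ?_
  rw [norm_inv, ← one_div]
  exact one_div_le_one_div_of_le hw (im_le_norm_sub l hw)

theorem norm_integral_cauchy_le {V : Measure ℝ} {f : ℝ → ℝ} (hf : Integrable f V) {w : ℂ} (hw : 0 < w.im) :
    ‖∫ l : ℝ, (f l : ℂ) / (l - w) ∂V‖ ≤ (∫ l, |f l| ∂V) / w.im := by
  rw [← integral_div]
  refine norm_integral_le_of_norm_le (hf.abs.div_const _)
    (Filter.Eventually.of_forall fun l => ?_)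
  rw [norm_div, Complex.norm_real, Real.norm_eq_abs]
  exact div_le_div_of_nonneg_left (abs_nonneg _) hw (im_le_norm_sub l hw)

section

variable {V : Measure ℝ} [IsFiniteMeasure V] {h : ℝ → ℝ}

theorem integrable_of_abs_le_one (hm : Measurable h) (h1 : ∀ l, |h l| ≤ 1) : Integrable h V :=
  Integrable.of_bound hm.aestronglyMeasurable 1 (Filter.Eventually.of_forall h1)

theorem differentiableOn_cauchyTransform (hm : Measurable h) (h1 : ∀ l, |h l| ≤ 1) :
    DifferentiableOn ℂ (cauchyTransform V h) {w | 0 < w.im} := by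
  intro w hw
  have hw : 0 < w.im := hw
  refine DifferentiableAt.differentiableWithinAt ?_
  have hmeas : ∀ v : ℂ, AEStronglyMeasurable (fun l : ℝ => (h l : ℂ) / (l - v)) V := fun v =>
    ((Complex.measurable_ofReal.comp hm).div
      (Complex.measurable_ofReal.sub measurable_const)).aestronglyMeasurable
  have hball : ∀ v ∈ Metric.ball w (w.im / 2), w.im / 2 ≤ v.im := by
    intro v hv
    have h2 := Complex.abs_im_le_norm (v - w)
    rw [Metric.mem_ball, dist_eq_norm] at hv
    rw [Complex.sub_im] at h2
    linarith [neg_abs_le (v.im - w.im)]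
  refine (hasDerivAt_integral_of_dominated_loc_of_deriv_le (𝕜 := ℂ) (μ := V)
    (F := fun (v : ℂ) (l : ℝ) => (h l : ℂ) / (l - v))
    (F' := fun (v : ℂ) (l : ℝ) => (h l : ℂ) / (l - v) ^ 2)
    (bound := fun _ => 1 / (w.im / 2) ^ 2)
    (Metric.ball_mem_nhds w (half_pos hw))
    (Filter.Eventually.of_forall hmeas)
    (integrable_cauchy (integrable_of_abs_le_one hm h1) hw) ?_ ?_ (integrable_const _) ?_).2.differentiableAt
  · exact ((Complex.measurable_ofReal.comp hm).div
      ((Complex.measurable_ofReal.sub measurable_const).pow_const 2)).aestronglyMeasurable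
  · refine Filter.Eventually.of_forall fun l v hv => ?_
    have h2 := hball v hv
    have h3 := im_le_norm_sub l (lt_of_lt_of_le (half_pos hw) h2)
    rw [norm_div, norm_pow, Complex.norm_real]
    have h4 := h1 l
    gcongr
    · exact h4
    · linarith
  · refine Filter.Eventually.of_forall fun l v hv => ?_
    have h2 := hball v hv
    have h3 := sub_ne_zero_of_im_pos l (lt_of_lt_of_le (half_pos hw) h2)
    have h4 := (((hasDerivAt_id v).const_sub (l : ℂ)).inv h3).const_mul (h l : ℂ)
    simp only [div_eq_mul_inv]
    refine h4.congr_deriv ?_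
    simp

/-- The Levitan-Meiman identity. -/
theorem cos_mul_cauchyTransform (hm : Measurable h) (h1 : ∀ l, |h l| ≤ 1) {x : ℝ} (hx : 0 ≤ x)
    (hxi : Integrable ((Iic (0 : ℝ)).indicator fun l => Real.exp (x * √|l|)) V)
    (hcos : ∀ t ∈ Icc 0 x, ∫ l, cosSqrt t l * h l ∂V = 0) {w ω : ℂ} (hw : 0 < w.im)
    (hω : ω ^ 2 = w) :
    Complex.cos (x * ω) * cauchyTransform V h w =
      ∫ l : ℝ, ((cosSqrt x l * h l : ℝ) : ℂ) / (l - w) ∂V := by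
  have hω0 : ω ≠ 0 := by
    rintro rfl
    simp [← hω] at hw
  have hch : Integrable (fun l => cosSqrt x l * h l) V :=
    (integrable_cosSqrt hxi hx le_rfl).mul_bdd hm.aestronglyMeasurable
      (Filter.Eventually.of_forall h1)
  have hswap : ∫ l, (∫ t in (0 : ℝ)..x, Complex.sin ((x - t) * ω) / ω * cosSqrt t l * h l) ∂V
      = 0 := by
    simp only [intervalIntegral.integral_of_le hx]
    obtain ⟨D, hD⟩ := (isCompact_Icc (a := (0 : ℝ)) (b := x)).exists_bound_of_continuousOn
      (f := fun t : ℝ => Complex.sin ((x - t) * ω) / ω) (by fun_prop)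
    rw [integral_integral_swap]
    · rw [setIntegral_congr_fun measurableSet_Ioc (g := fun _ => 0)]
      · simp
      · intro t ht
        have h2 := hcos t ⟨ht.1.le, ht.2⟩
        simp only [mul_assoc]
        rw [integral_const_mul]
        simp only [← Complex.ofReal_mul]
        rw [integral_complex_ofReal, h2]
        simp
    · have hb : Integrable (fun z : ℝ × ℝ => (1 + (Iic (0 : ℝ)).indicator
          (fun l => Real.exp (x * √|l|)) z.1) * D) (V.prod (volume.restrict (Ioc 0 x))) :=
        ((integrable_const (1 : ℝ)).add hxi).mul_prod (integrable_const D)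
      refine hb.mono' ?_ ?_
      · refine Measurable.aestronglyMeasurable ?_
        have h3 : Measurable fun z : ℝ × ℝ => cosSqrt z.2 z.1 :=
          measurable_cosSqrt.comp measurable_swap
        have h4 : Measurable fun z : ℝ × ℝ => h z.1 := hm.comp measurable_fst
        have h5 : Measurable fun z : ℝ × ℝ => Complex.sin ((x - z.2) * ω) / ω := by fun_prop
        exact (h5.mul (Complex.measurable_ofReal.comp h3)).mul (Complex.measurable_ofReal.comp h4)
      · have hae : ∀ᵐ z ∂(V.prod (volume.restrict (Ioc 0 x))), z.2 ∈ Ioc 0 x :=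
          Measure.quasiMeasurePreserving_snd.ae (ae_restrict_mem measurableSet_Ioc)
        filter_upwards [hae] with z hz
        simp only [Function.uncurry, norm_mul, Complex.norm_real, Real.norm_eq_abs]
        have h3 := hD z.2 ⟨hz.1.le, hz.2⟩
        have h4 := abs_cosSqrt_le (l := z.1) hz.1.le hz.2
        have h5 := h1 z.1
        have h6 : 0 ≤ D := (norm_nonneg _).trans h3
        calc _ ≤ D * (1 + (Iic (0 : ℝ)).indicator (fun l => Real.exp (x * √|l|)) z.1) * 1 := by
              have h7 := (abs_nonneg _).trans h4
              gcongr
          _ = _ := by ring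
  have hpt : ∀ l : ℝ, ∫ t in (0 : ℝ)..x, Complex.sin ((x - t) * ω) / ω * cosSqrt t l * h l =
      Complex.cos (x * ω) * ((h l : ℂ) / (l - w)) - ((cosSqrt x l * h l : ℝ) : ℂ) / (l - w) := by
    intro l
    have h2 := sub_ne_zero_of_im_pos l hw
    have h3 : w - l ≠ 0 := by
      rw [← neg_sub]
      exact neg_ne_zero.2 h2
    rw [intervalIntegral.integral_mul_const, integral_sin_mul_cosSqrt hω0
      (by rw [hω]; exact sub_ne_zero.1 h3), ← cosSqrt_eq, hω, ← neg_sub (l : ℂ) w]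
    push_cast
    field_simp
    ring
  simp only [hpt] at hswap
  rw [integral_sub ((integrable_cauchy (integrable_of_abs_le_one hm h1) hw).const_mul _)
    (integrable_cauchy hch hw), integral_const_mul, sub_eq_zero] at hswap
  exact hswap

end

theorem exists_subgradient {p : ℝ → ℝ} (hp_mono : MonotoneOn p (Ici 0))
    (hp_conv : ConvexOn ℝ (Ici 0) p) {s : ℝ} (hs : 0 < s) :
    ∃ x, 0 ≤ x ∧ ∀ u, 0 ≤ u → p s + x * (u - s) ≤ p u := by
  have hsi : s ∈ interior (Ici (0 : ℝ)) := by simpa using hs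
  have hright : ∀ u, s < u → derivWithin p (Ioi s) s ≤ slope p s u := fun u hu =>
    hp_conv.rightDeriv_le_slope_of_mem_interior hsi (hs.trans hu).le hu
  have hleft : ∀ u, 0 ≤ u → u < s → slope p u s ≤ derivWithin p (Ioi s) s := fun u hu0 hu =>
    (hp_conv.slope_le_leftDeriv_of_mem_interior hu0 hsi hu).trans
      (hp_conv.leftDeriv_le_rightDeriv_of_mem_interior hsi)
  refine ⟨derivWithin p (Ioi s) s, ?_, fun u hu => ?_⟩
  · refine le_trans ?_ (hleft 0 le_rfl hs)
    rw [slope_def_field]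
    have := hp_mono (mem_Ici.2 le_rfl) (mem_Ici.2 hs.le) hs.le
    exact div_nonneg (by linarith) (by linarith)
  · rcases lt_trichotomy u s with h | rfl | h
    · have := hleft u hu h
      rw [slope_def_field, div_le_iff₀ (by linarith)] at this
      linarith
    · simp
    · have := hright u h
      rw [slope_def_field, le_div_iff₀ (by linarith)] at this
      linarith

theorem exp_conjugate_le {p : ℝ → ℝ} {s x : ℝ} (h : ∀ u, 0 ≤ u → p s + x * (u - s) ≤ p u) :
    (conjugate p x).exp ≤ ENNReal.ofReal (Real.exp (x * s - p s)) := by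
  rw [← EReal.exp_coe]
  refine EReal.exp_monotone (iSup₂_le fun u hu => ?_)
  rw [EReal.coe_le_coe_iff]
  have := h u hu
  linarith

theorem sinh_le_norm_cos (z : ℂ) : (Real.exp |z.im| - Real.exp (-|z.im|)) / 2 ≤ ‖Complex.cos z‖ := by
  rw [Complex.cos, norm_div, Complex.norm_two]
  refine div_le_div_of_nonneg_right ?_ two_pos.le
  have h1 : ‖Complex.exp (z * Complex.I)‖ = Real.exp (-z.im) := by simp [Complex.norm_exp]
  have h2 : ‖Complex.exp (-z * Complex.I)‖ = Real.exp z.im := by simp [Complex.norm_exp]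
  rcases le_total 0 z.im with h | h
  · rw [abs_of_nonneg h, ← h1, ← h2, add_comm]
    exact norm_sub_le_norm_add _ _
  · rw [abs_of_nonpos h, neg_neg, ← h1, ← h2]
    exact norm_sub_le_norm_add _ _

theorem norm_cauchyTransform_le {p : ℝ → ℝ} (hp_mono : MonotoneOn p (Ici 0))
    (hp_conv : ConvexOn ℝ (Ici 0) p) {V : Measure ℝ} [IsFiniteMeasure V] {h : ℝ → ℝ}
    (hm : Measurable h) (h1 : ∀ l, |h l| ≤ 1) {C : ℝ} (hC : 0 < C)
    (hgrowth : ∀ x, 0 ≤ x → ∫⁻ l in Iic (0 : ℝ), ENNReal.ofReal (Real.exp (x * √|l|)) ∂V ≤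
      ENNReal.ofReal C * (conjugate p x).exp)
    (hcos : ∀ x, 0 ≤ x → Integrable (fun l => cosSqrt x l) V → ∫ l, cosSqrt x l * h l ∂V = 0)
    {w : ℂ} (hw : 0 < w.im) :
    ‖cauchyTransform V h w‖ ≤ 4 * (C + V.real univ * Real.exp (p 0 + 1)) *
      Real.exp (-p (√((‖w‖ - w.re) / 2))) / w.im := by
  obtain ⟨ω, hω⟩ : ∃ ω : ℂ, ω ^ 2 = w := IsAlgClosed.exists_pow_nat_eq w two_pos
  set s := |ω.im| with hs
  have hs2 : (‖w‖ - w.re) / 2 = s ^ 2 := by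
    rw [hs, sq_abs, ← hω, norm_pow, ← Complex.normSq_eq_norm_sq, Complex.normSq_apply, pow_two ω,
      Complex.mul_re]
    ring
  have hs0 : 0 < s := by
    refine abs_pos.2 fun h0 => ?_
    rw [← hω, pow_two, Complex.mul_im, h0] at hw
    simp at hw
  rw [hs2, Real.sqrt_sq hs0.le]
  obtain ⟨x, hx, hsub⟩ := exists_subgradient hp_mono hp_conv hs0
  have hM : ∫⁻ l in Iic (0 : ℝ), ENNReal.ofReal (Real.exp (x * √|l|)) ∂V ≤
      ENNReal.ofReal (C * Real.exp (x * s - p s)) := by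
    rw [ENNReal.ofReal_mul hC.le]
    exact (hgrowth x hx).trans (by gcongr; exact exp_conjugate_le hsub)
  have hmeas : Measurable fun l : ℝ => Real.exp (x * √|l|) := by fun_prop
  have hxi : Integrable ((Iic (0 : ℝ)).indicator fun l => Real.exp (x * √|l|)) V := by
    rw [integrable_indicator_iff measurableSet_Iic]
    refine ⟨hmeas.aestronglyMeasurable, ?_⟩
    rw [hasFiniteIntegral_iff_ofReal (Filter.Eventually.of_forall fun _ => (Real.exp_pos _).le)]
    exact hM.trans_lt ENNReal.ofReal_lt_top
  have hxi_le : ∫ l, (Iic (0 : ℝ)).indicator (fun l => Real.exp (x * √|l|)) l ∂V ≤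
      C * Real.exp (x * s - p s) := by
    rw [integral_indicator measurableSet_Iic, integral_eq_lintegral_of_nonneg_ae
      (Filter.Eventually.of_forall fun _ => (Real.exp_pos _).le) hmeas.aestronglyMeasurable]
    exact ENNReal.toReal_le_of_le_ofReal (by positivity) hM
  have hV : 0 ≤ V.real univ := measureReal_nonneg
  have hEp := Real.exp_pos (-p s)
  by_cases hxs : x * s < 1
  · have h2 : ‖cauchyTransform V h w‖ ≤ V.real univ / w.im := by
      refine (norm_integral_cauchy_le (integrable_of_abs_le_one hm h1) hw).trans ?_
      gcongr
      have := integral_mono (μ := V) (integrable_of_abs_le_one hm h1).abs (integrable_const 1) h1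
      simpa using this
    refine h2.trans ?_
    gcongr
    have h3 : p s ≤ p 0 + 1 := by
      have := hsub 0 le_rfl
      linarith
    have h4 : 1 ≤ Real.exp (p 0 + 1) * Real.exp (-p s) := by
      rw [← Real.exp_add]
      exact Real.one_le_exp (by linarith)
    have h5 : V.real univ ≤ V.real univ * (Real.exp (p 0 + 1) * Real.exp (-p s)) :=
      le_mul_of_one_le_right hV h4
    have h6 := mul_pos hC hEp
    nlinarith
  · push Not at hxs
    have hid := cos_mul_cauchyTransform hm h1 hx hxi (fun t ht => hcos t ht.1
      (integrable_cosSqrt hxi ht.1 ht.2)) hw hω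
    have hch : Integrable (fun l => cosSqrt x l * h l) V :=
      (integrable_cosSqrt hxi hx le_rfl).mul_bdd hm.aestronglyMeasurable
        (Filter.Eventually.of_forall h1)
    have h2 : ‖Complex.cos (x * ω) * cauchyTransform V h w‖ ≤
        (V.real univ + C * Real.exp (x * s - p s)) / w.im := by
      rw [hid]
      refine (norm_integral_cauchy_le hch hw).trans ?_
      gcongr
      have h3 : ∫ l, |cosSqrt x l * h l| ∂V ≤
          ∫ l, (1 + (Iic (0 : ℝ)).indicator (fun l => Real.exp (x * √|l|)) l) ∂V := by
        refine integral_mono hch.abs ((integrable_const 1).add hxi) fun l => ?_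
        simp only [abs_mul]
        exact (mul_le_of_le_one_right (abs_nonneg _) (h1 l)).trans (abs_cosSqrt_le hx le_rfl)
      rw [integral_add (integrable_const 1) hxi] at h3
      simp only [integral_const, smul_eq_mul, mul_one] at h3
      linarith
    have h3 : Real.exp (x * s) / 4 ≤ ‖Complex.cos (x * ω)‖ := by
      refine le_trans ?_ (sinh_le_norm_cos _)
      have him : |((x : ℂ) * ω).im| = x * s := by
        simp [hs, abs_mul, abs_of_nonneg hx]
      rw [him]
      have h4 : Real.exp (-(x * s)) ≤ 1 := Real.exp_le_one_iff.2 (by linarith)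
      have h5 : 2 ≤ Real.exp (x * s) := by linarith [Real.add_one_le_exp (x * s)]
      linarith
    rw [norm_mul] at h2
    have h4 : Real.exp (x * s) / 4 * ‖cauchyTransform V h w‖ ≤
        (V.real univ + C * Real.exp (x * s - p s)) / w.im :=
      (mul_le_mul_of_nonneg_right h3 (norm_nonneg _)).trans h2
    have h5 : V.real univ + C * Real.exp (x * s - p s) ≤
        Real.exp (x * s) * ((C + V.real univ * Real.exp (p 0 + 1)) * Real.exp (-p s)) := by
      have h6 : Real.exp (x * s - p s) = Real.exp (x * s) * Real.exp (-p s) := by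
        rw [← Real.exp_add, sub_eq_add_neg]
      have h7 : 1 ≤ Real.exp (x * s) * (Real.exp (p 0 + 1) * Real.exp (-p s)) := by
        rw [← Real.exp_add, ← Real.exp_add]
        refine Real.one_le_exp ?_
        have := hsub 0 le_rfl
        linarith
      have h8 := mul_le_mul_of_nonneg_left h7 hV
      rw [h6]
      nlinarith
    rw [le_div_iff₀ hw] at h4 ⊢
    have hE := Real.exp_pos (x * s)
    refine le_of_mul_le_mul_left ?_ hE
    nlinarith

section

variable {V : Measure ℝ} [IsFiniteMeasure V] {h : ℝ → ℝ}

theorem poisson_integral_eq_zero (hm : Measurable h) (h1 : ∀ l, |h l| ≤ 1)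
    (hzero : ∀ w : ℂ, 0 < w.im → cauchyTransform V h w = 0) {y : ℝ} (hy : 0 < y) (x : ℝ) :
    ∫ l, h l * (y / ((x - l) ^ 2 + y ^ 2)) ∂V = 0 := by
  have hw : 0 < (⟨x, y⟩ : ℂ).im := hy
  have h2 := Complex.imCLM.integral_comp_comm
    (integrable_cauchy (integrable_of_abs_le_one (V := V) hm h1) hw)
  have h3 : ∫ l : ℝ, (h l : ℂ) / (l - ⟨x, y⟩) ∂V = 0 := hzero _ hw
  rw [h3] at h2
  simp only [Complex.imCLM_apply, Complex.zero_im] at h2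
  rw [← h2]
  refine integral_congr_ae (Filter.Eventually.of_forall fun l => ?_)
  simp [Complex.div_im, Complex.normSq_apply]
  ring_nf

theorem integral_arctan_eq_zero (hm : Measurable h) (h1 : ∀ l, |h l| ≤ 1)
    (hzero : ∀ w : ℂ, 0 < w.im → cauchyTransform V h w = 0) {y : ℝ} (hy : 0 < y) {a b : ℝ}
    (hab : a ≤ b) :
    ∫ l, h l * (Real.arctan ((b - l) / y) - Real.arctan ((a - l) / y)) ∂V = 0 := by
  have hpt : ∀ l, ∫ x in a..b, h l * (y / ((x - l) ^ 2 + y ^ 2)) =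
      h l * (Real.arctan ((b - l) / y) - Real.arctan ((a - l) / y)) := by
    intro l
    rw [intervalIntegral.integral_const_mul]
    congr 1
    refine intervalIntegral.integral_eq_sub_of_hasDerivAt
      (f := fun x => Real.arctan ((x - l) / y)) (fun x _ => ?_) ?_
    · have := (((hasDerivAt_id x).sub_const l).div_const y).arctan
      refine this.congr_deriv ?_
      simp only [id]
      field_simp
      ring
    · refine Continuous.intervalIntegrable ?_ _ _
      exact continuous_const.div (by fun_prop) fun x => by positivity
  simp only [← hpt, intervalIntegral.integral_of_le hab]
  rw [integral_integral_swap]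
  · simp [poisson_integral_eq_zero hm h1 hzero hy]
  · refine Integrable.of_bound ?_ (1 / y) (Filter.Eventually.of_forall fun z => ?_)
    · exact Measurable.aestronglyMeasurable
        ((hm.comp measurable_fst).mul (by fun_prop))
    · rw [Function.uncurry, norm_mul, Real.norm_eq_abs, Real.norm_eq_abs]
      refine (mul_le_of_le_one_left (abs_nonneg _) (h1 _)).trans ?_
      rw [abs_of_pos (by positivity), div_le_div_iff₀ (by positivity) hy]
      nlinarith [sq_nonneg (z.2 - z.1)]

theorem tendsto_arctan_div (u : ℝ) :
    Filter.Tendsto (fun n : ℕ => Real.arctan (u / (1 / ((n : ℝ) + 1)))) Filter.atTop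
      (nhds (Real.pi / 2 * Real.sign u)) := by
  have hn : Filter.Tendsto (fun n : ℕ => (n : ℝ) + 1) Filter.atTop Filter.atTop :=
    Filter.tendsto_atTop_add_const_right _ _ tendsto_natCast_atTop_atTop
  simp only [div_div_eq_mul_div, div_one]
  rcases lt_trichotomy u 0 with hu | rfl | hu
  · rw [Real.sign_of_neg hu, mul_neg_one]
    exact (Real.tendsto_arctan_atBot.mono_right nhdsWithin_le_nhds).comp
      (hn.const_mul_atTop_of_neg hu)
  · simp
  · rw [Real.sign_of_pos hu, mul_one]
    exact (Real.tendsto_arctan_atTop.mono_right nhdsWithin_le_nhds).comp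
      (hn.const_mul_atTop hu)

theorem integral_sign_eq_zero (hm : Measurable h) (h1 : ∀ l, |h l| ≤ 1)
    (hzero : ∀ w : ℂ, 0 < w.im → cauchyTransform V h w = 0) {a b : ℝ} (hab : a ≤ b) :
    ∫ l, h l * (Real.pi / 2 * Real.sign (b - l) - Real.pi / 2 * Real.sign (a - l)) ∂V = 0 := by
  have hlim := tendsto_integral_of_dominated_convergence (μ := V)
    (F := fun (n : ℕ) l => h l * (Real.arctan ((b - l) / (1 / ((n : ℝ) + 1))) -
      Real.arctan ((a - l) / (1 / ((n : ℝ) + 1)))))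
    (f := fun l => h l * (Real.pi / 2 * Real.sign (b - l) - Real.pi / 2 * Real.sign (a - l)))
    (fun _ => Real.pi)
    (fun n => (hm.mul (by fun_prop)).aestronglyMeasurable) (integrable_const _)
    (fun n => Filter.Eventually.of_forall fun l => by
      rw [norm_mul, Real.norm_eq_abs, Real.norm_eq_abs]
      refine (mul_le_of_le_one_left (abs_nonneg _) (h1 _)).trans ?_
      rw [abs_le]
      have h2 := Real.arctan_lt_pi_div_two ((b - l) / (1 / ((n : ℝ) + 1)))
      have h3 := Real.neg_pi_div_two_lt_arctan ((b - l) / (1 / ((n : ℝ) + 1)))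
      have h4 := Real.arctan_lt_pi_div_two ((a - l) / (1 / ((n : ℝ) + 1)))
      have h5 := Real.neg_pi_div_two_lt_arctan ((a - l) / (1 / ((n : ℝ) + 1)))
      constructor <;> linarith)
    (Filter.Eventually.of_forall fun l =>
      ((tendsto_arctan_div (b - l)).sub (tendsto_arctan_div (a - l))).const_mul (h l))
  have hz : ∀ n : ℕ, ∫ l, h l * (Real.arctan ((b - l) / (1 / ((n : ℝ) + 1))) -
      Real.arctan ((a - l) / (1 / ((n : ℝ) + 1)))) ∂V = 0 := fun n =>
    integral_arctan_eq_zero hm h1 hzero (by positivity) hab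
  simp only [hz] at hlim
  exact (tendsto_nhds_unique tendsto_const_nhds hlim).symm

/-- The Stieltjes inversion formula for a vanishing transform. -/
theorem setIntegral_eq_zero_of_cauchyTransform (hm : Measurable h) (h1 : ∀ l, |h l| ≤ 1)
    (hzero : ∀ w : ℂ, 0 < w.im → cauchyTransform V h w = 0) {a b : ℝ} (hab : a < b) :
    2 * ∫ l in Ioo a b, h l ∂V + ∫ l in {a}, h l ∂V + ∫ l in {b}, h l ∂V = 0 := by
  have h2 := integral_sign_eq_zero hm h1 hzero hab.le
  have hint := integrable_of_abs_le_one (V := V) hm h1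
  have hpt : ∀ l, h l * (Real.pi / 2 * Real.sign (b - l) - Real.pi / 2 * Real.sign (a - l)) =
      Real.pi / 2 * (2 * (Ioo a b).indicator h l + ({a} : Set ℝ).indicator h l +
        ({b} : Set ℝ).indicator h l) := by
    intro l
    rcases lt_trichotomy l a with h3 | rfl | h3
    · have h4 : l < b := h3.trans hab
      simp [Real.sign_of_pos (sub_pos.2 h3), Real.sign_of_pos (sub_pos.2 h4), h3.not_gt, h3.ne,
        h4.ne]
    · simp [Real.sign_of_pos (sub_pos.2 hab), hab.ne]
      ring
    · rcases lt_trichotomy l b with h4 | rfl | h4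
      · simp [Real.sign_of_neg (sub_neg.2 h3), Real.sign_of_pos (sub_pos.2 h4), h3, h4, h3.ne',
          h4.ne]
        ring
      · simp [Real.sign_of_neg (sub_neg.2 h3), h3.ne']
        ring
      · simp [Real.sign_of_neg (sub_neg.2 h3), Real.sign_of_neg (sub_neg.2 h4), h4.not_gt, h3.ne',
          h4.ne']
  simp only [hpt] at h2
  have hi1 : Integrable ((Ioo a b).indicator h) V := hint.indicator measurableSet_Ioo
  have hi2 : Integrable (({a} : Set ℝ).indicator h) V := hint.indicator (measurableSet_singleton a)
  have hi3 : Integrable (({b} : Set ℝ).indicator h) V := hint.indicator (measurableSet_singleton b)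
  have hi12 : Integrable (fun l => 2 * (Ioo a b).indicator h l + ({a} : Set ℝ).indicator h l) V :=
    (hi1.const_mul 2).add hi2
  rw [integral_const_mul, integral_add hi12 hi3,
    integral_add (hi1.const_mul 2) hi2, integral_const_mul, integral_indicator measurableSet_Ioo,
    integral_indicator (measurableSet_singleton a),
    integral_indicator (measurableSet_singleton b)] at h2
  exact (mul_eq_zero.1 h2).resolve_left (by positivity)

end

theorem uniqueness {p : ℝ → ℝ} (hp_nonneg : ∀ s, 0 ≤ s → 0 ≤ p s)
    (hp_mono : MonotoneOn p (Ici 0)) (hp_conv : ConvexOn ℝ (Ici 0) p) (hp : vulIntegral p = ⊤)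
    {σ : ℝ → ℝ} (hσ : BoundedVariationOn σ univ) (hmaj : Majorized p hσ)
    (hcos : ∀ x : ℝ, cosTransform hσ x = 0) :
    ∃ c : ℝ, ∀ l : ℝ,
      (ContinuousWithinAt σ (Ici l) l ∨ ContinuousWithinAt σ (Iic l) l) → σ l = c := by
  obtain ⟨C, hC, hgrowth⟩ := hmaj
  obtain ⟨h, hm, h1, hint, hset⟩ := exists_sign hσ.vectorMeasure
  have hfin := isFiniteMeasure_variation hσ.vectorMeasure
  have hzero : ∀ w : ℂ, 0 < w.im → cauchyTransform hσ.vectorMeasure.variation h w = 0 := by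
    have hV : 0 ≤ hσ.vectorMeasure.variation.real univ := measureReal_nonneg
    refine fun w hw => eq_zero_of_decay hp_nonneg hp_mono hp
      (differentiableOn_cauchyTransform hm h1) (by positivity)
      (fun w hw => norm_cauchyTransform_le hp_mono hp_conv hm h1 hC hgrowth
        (fun x hx hxi => ?_) hw) w hw
    rw [← hint _ hxi]
    exact hcos x
  have hmean : ∀ a b : ℝ, a < b →
      σ.rightLim a + σ.leftLim a = σ.rightLim b + σ.leftLim b := by
    intro a b hab
    have h2 := setIntegral_eq_zero_of_cauchyTransform hm h1 hzero hab
    rw [← hset _ measurableSet_Ioo, ← hset _ (measurableSet_singleton a),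
      ← hset _ (measurableSet_singleton b), hσ.vectorMeasure_Ioo hab, hσ.vectorMeasure_singleton,
      hσ.vectorMeasure_singleton] at h2
    linarith
  have hmean' : ∀ a, σ.rightLim a + σ.leftLim a = σ.rightLim 0 + σ.leftLim 0 := by
    intro a
    rcases lt_trichotomy a 0 with h2 | rfl | h2
    · exact hmean a 0 h2
    · rfl
    · exact (hmean 0 a h2).symm
  have hR : ∀ a, σ.rightLim a + σ.rightLim a = σ.rightLim 0 + σ.leftLim 0 := by
    intro a
    have h2 := hσ.rightLim.tendsto_rightLim a
    have h3 := hσ.leftLim.tendsto_rightLim a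
    rw [rightLim_rightLim (hσ.tendsto_rightLim a)] at h2
    rw [rightLim_leftLim (hσ.tendsto_rightLim a)] at h3
    have h4 := h2.add h3
    simp only [hmean'] at h4
    exact tendsto_nhds_unique h4 tendsto_const_nhds
  have hL : ∀ a, σ.leftLim a = σ.rightLim a := fun a => by
    have h2 := hR a
    have h3 := hmean' a
    linarith
  refine ⟨(σ.rightLim 0 + σ.leftLim 0) / 2, fun l hl => ?_⟩
  have h2 : σ l = σ.rightLim l := by
    rcases hl with hl | hl
    · exact tendsto_nhds_unique (hl.mono Ioi_subset_Ici_self).tendsto (hσ.tendsto_rightLim l)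
    · rw [← hL]
      exact tendsto_nhds_unique (hl.mono Iio_subset_Iic_self).tendsto (hσ.tendsto_leftLim l)
  have h3 := hR l
  linarith

theorem summable_dyadic {p : ℝ → ℝ} (hp_nonneg : ∀ s, 0 ≤ s → 0 ≤ p s)
    (hp_mono : MonotoneOn p (Ici 0)) (hp : vulIntegral p ≠ ⊤) :
    Summable fun n : ℕ => p (2 ^ (n + 1)) / 4 ^ n := by
  set I : ℕ → Set ℝ := fun n => Ioc (2 ^ (n + 1)) (2 ^ (n + 2)) with hI
  have hdisj : Pairwise (Function.onFun Disjoint I) := by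
    have hmono : Monotone fun n : ℕ => (2 : ℝ) ^ (n + 1) := fun m n hmn =>
      pow_le_pow_right₀ one_le_two (by omega)
    exact hmono.pairwise_disjoint_on_Ioc_succ
  have hle : ∀ n, ENNReal.ofReal (p (2 ^ (n + 1)) / 4 ^ n / 32) ≤
      ∫⁻ s in I n, ENNReal.ofReal (p s / s ^ 3) := by
    intro n
    have h2 : (0 : ℝ) < 2 ^ n := by positivity
    have h4 : (4 : ℝ) ^ n = (2 ^ n) ^ 2 := by rw [← pow_mul, mul_comm, pow_mul]; norm_num
    calc ENNReal.ofReal (p (2 ^ (n + 1)) / 4 ^ n / 32)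
        = ENNReal.ofReal (p (2 ^ (n + 1)) / (2 ^ (n + 2)) ^ 3) * volume (I n) := by
          rw [hI, Real.volume_Ioc, ← ENNReal.ofReal_mul
            (div_nonneg (hp_nonneg _ (by positivity)) (by positivity))]
          congr 1
          rw [h4]
          simp only [pow_succ]
          field_simp
          ring
      _ = ∫⁻ s in I n, ENNReal.ofReal (p (2 ^ (n + 1)) / (2 ^ (n + 2)) ^ 3) := by
          rw [setLIntegral_const]
      _ ≤ ∫⁻ s in I n, ENNReal.ofReal (p s / s ^ 3) := by
          refine setLIntegral_mono' measurableSet_Ioc fun s hs => ENNReal.ofReal_le_ofReal ?_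
          have hs0 : 0 < s := lt_trans (by positivity) hs.1
          have h5 : p (2 ^ (n + 1)) ≤ p s :=
            hp_mono (mem_Ici.2 (by positivity)) hs0.le hs.1.le
          have h6 := hp_nonneg s hs0.le
          have h7 := hs.2
          gcongr
  have hsum : ∑' n, ENNReal.ofReal (p (2 ^ (n + 1)) / 4 ^ n / 32) ≠ ⊤ := by
    refine ne_top_of_le_ne_top hp ?_
    calc _ ≤ ∑' n, ∫⁻ s in I n, ENNReal.ofReal (p s / s ^ 3) := ENNReal.tsum_le_tsum hle
      _ = ∫⁻ s in ⋃ n, I n, ENNReal.ofReal (p s / s ^ 3) :=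
          (lintegral_iUnion (fun n => measurableSet_Ioc) hdisj _).symm
      _ ≤ vulIntegral p := by
          refine lintegral_mono_set (iUnion_subset fun n s hs => lt_of_le_of_lt ?_ hs.1)
          exact one_le_pow₀ one_le_two
  have h3 := ENNReal.summable_toReal hsum
  have h4 : ∀ n : ℕ, (ENNReal.ofReal (p (2 ^ (n + 1)) / 4 ^ n / 32)).toReal =
      p (2 ^ (n + 1)) / 4 ^ n / 32 := fun n =>
    ENNReal.toReal_ofReal (div_nonneg (div_nonneg (hp_nonneg _ (by positivity))
      (by positivity)) (by norm_num))
  simp only [h4] at h3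
  exact (summable_div_const_iff (by norm_num)).1 h3

/-- A function with non-negative real part in the right half-plane whose real part on the imaginary
axis majorizes `a n` at distance at least `4 ^ n` from the origin. -/
noncomputable def majorant (a : ℕ → ℝ) (z : ℂ) : ℂ := ∑' n : ℕ, 2 * a n * (z / (4 ^ n + z))

theorem norm_majorant_term_le {a : ℕ → ℝ} (ha : ∀ n, 0 ≤ a n) {R : ℝ} {z : ℂ}
    (hz : -(1 / 2) < z.re) (hzR : ‖z‖ ≤ R) (n : ℕ) :
    ‖2 * a n * (z / (4 ^ n + z))‖ ≤ 4 * R * (a n / 4 ^ n) := by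
  have h1 : (1 : ℝ) ≤ 4 ^ n := one_le_pow₀ (by norm_num)
  have h2 : (4 : ℝ) ^ n / 2 ≤ ‖(4 ^ n + z : ℂ)‖ := by
    refine le_trans ?_ (Complex.re_le_norm _)
    have : ((4 : ℂ) ^ n).re = 4 ^ n := by
      rw [← Complex.ofReal_ofNat, ← Complex.ofReal_pow, Complex.ofReal_re]
    rw [Complex.add_re, this]
    linarith
  rw [norm_mul, norm_mul, norm_div, Complex.norm_real, Complex.norm_two, Real.norm_of_nonneg (ha n)]
  have h3 : ‖z‖ / ‖(4 ^ n + z : ℂ)‖ ≤ R / (4 ^ n / 2) :=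
    div_le_div₀ ((norm_nonneg _).trans hzR) hzR (by positivity) h2
  calc 2 * a n * (‖z‖ / ‖(4 ^ n + z : ℂ)‖) ≤ 2 * a n * (R / (4 ^ n / 2)) :=
        mul_le_mul_of_nonneg_left h3 (by linarith [ha n])
    _ = _ := by field_simp; ring

theorem four_pow_add_ne_zero {z : ℂ} (hz : -(1 / 2) < z.re) (n : ℕ) : (4 ^ n + z : ℂ) ≠ 0 := by
  intro h
  have h1 : (1 : ℝ) ≤ 4 ^ n := one_le_pow₀ (by norm_num)
  have h2 : ((4 : ℂ) ^ n).re = 4 ^ n := by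
    rw [← Complex.ofReal_ofNat, ← Complex.ofReal_pow, Complex.ofReal_re]
  have h3 := congrArg Complex.re h
  rw [Complex.add_re, h2, Complex.zero_re] at h3
  linarith

theorem differentiableOn_majorant {a : ℕ → ℝ} (ha : ∀ n, 0 ≤ a n)
    (hs : Summable fun n => a n / 4 ^ n) :
    DifferentiableOn ℂ (majorant a) {z | -(1 / 2) < z.re} := by
  intro z hz
  have hopen : IsOpen ({z : ℂ | -(1 / 2) < z.re} ∩ Metric.ball 0 (‖z‖ + 1)) :=
    (isOpen_lt continuous_const Complex.continuous_re).inter Metric.isOpen_ball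
  have hmem : z ∈ {z : ℂ | -(1 / 2) < z.re} ∩ Metric.ball 0 (‖z‖ + 1) := ⟨hz, by simp⟩
  have h1 : DifferentiableOn ℂ (majorant a)
      ({z : ℂ | -(1 / 2) < z.re} ∩ Metric.ball 0 (‖z‖ + 1)) := by
    refine Complex.differentiableOn_tsum_of_summable_norm
      (hs.mul_left (4 * (‖z‖ + 1))) (fun n => ?_) hopen (fun n w hw => ?_)
    · refine (differentiableOn_const _).mul (differentiableOn_id.div (by fun_prop) ?_)
      exact fun w hw => four_pow_add_ne_zero hw.1 n
    · exact norm_majorant_term_le ha hw.1 (le_of_lt (by simpa using hw.2)) n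
  exact (h1.differentiableAt (hopen.mem_nhds hmem)).differentiableWithinAt

theorem re_div_add {T : ℝ} (z : ℂ) :
    (z / (T + z)).re = (z.re * T + Complex.normSq z) / Complex.normSq (T + z) := by
  simp [Complex.div_re, Complex.normSq_apply]
  ring

theorem re_majorant_term_nonneg {a : ℕ → ℝ} (ha : ∀ n, 0 ≤ a n) {z : ℂ} (hz : 0 ≤ z.re) (n : ℕ) :
    0 ≤ (2 * a n * (z / (4 ^ n + z))).re := by
  have h1 : (2 * a n * (z / (4 ^ n + z))) = ((2 * a n : ℝ) : ℂ) * (z / ((4 ^ n : ℝ) + z)) := by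
    push_cast
    rfl
  rw [h1, Complex.re_ofReal_mul, re_div_add]
  exact mul_nonneg (by linarith [ha n])
    (div_nonneg (by have := Complex.normSq_nonneg z; positivity) (Complex.normSq_nonneg _))

theorem hasSum_re_majorant {a : ℕ → ℝ} (ha : ∀ n, 0 ≤ a n)
    (hs : Summable fun n => a n / 4 ^ n) {z : ℂ} (hz : 0 ≤ z.re) :
    HasSum (fun n => (2 * a n * (z / (4 ^ n + z))).re) (majorant a z).re := by
  refine Complex.hasSum_re (Summable.hasSum ?_)
  exact Summable.of_norm_bounded (hs.mul_left (4 * ‖z‖)) fun n =>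
    norm_majorant_term_le ha (by linarith) le_rfl n

theorem re_majorant_nonneg {a : ℕ → ℝ} (ha : ∀ n, 0 ≤ a n)
    (hs : Summable fun n => a n / 4 ^ n) {z : ℂ} (hz : 0 ≤ z.re) : 0 ≤ (majorant a z).re :=
  (hasSum_re_majorant ha hs hz).nonneg fun n => re_majorant_term_nonneg ha hz n

theorem le_re_majorant {a : ℕ → ℝ} (ha : ∀ n, 0 ≤ a n)
    (hs : Summable fun n => a n / 4 ^ n) {y : ℝ} {n : ℕ} (hy : 4 ^ n ≤ |y|) :
    a n ≤ (majorant a (y * Complex.I)).re := by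
  have hz : 0 ≤ ((y : ℂ) * Complex.I).re := by simp
  refine le_trans ?_ (le_hasSum (hasSum_re_majorant ha hs hz) n fun m _ =>
    re_majorant_term_nonneg ha hz m)
  have h1 : (2 * a n * (y * Complex.I / (4 ^ n + y * Complex.I)) : ℂ) =
      ((2 * a n : ℝ) : ℂ) * (y * Complex.I / ((4 ^ n : ℝ) + y * Complex.I)) := by
    push_cast
    rfl
  rw [h1, Complex.re_ofReal_mul, re_div_add]
  have h2 : (4 : ℝ) ^ n * 4 ^ n ≤ y * y := by
    rw [← abs_mul_abs_self y]
    exact mul_self_le_mul_self (by positivity) hy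
  have h3 : (0 : ℝ) < 4 ^ n * 4 ^ n := by positivity
  have h4 : 1 / 2 ≤ ((y * Complex.I : ℂ).re * 4 ^ n + Complex.normSq (y * Complex.I)) /
      Complex.normSq (((4 ^ n : ℝ) : ℂ) + y * Complex.I) := by
    simp only [Complex.normSq_apply, Complex.add_re, Complex.add_im, Complex.ofReal_re,
      Complex.ofReal_im, Complex.mul_re, Complex.mul_im, Complex.I_re, Complex.I_im]
    simp only [mul_zero, mul_one, zero_add, add_zero, sub_self, zero_mul]
    rw [div_le_div_iff₀ (by norm_num) (by nlinarith)]
    linarith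
  nlinarith [ha n]

theorem exp_sqrt_sub_le {A κ : ℝ} (hA : 0 ≤ A) (hκ : 0 < κ) :
    ∃ M, 0 < M ∧ ∀ u, 0 ≤ u → Real.exp (A * √u - κ * u ^ (3 / 4 : ℝ)) ≤ M / (1 + u ^ 2) := by
  set v₀ := (A + 1) / κ + 1 with hv₀
  set B := A * v₀ ^ 2 + v₀
  refine ⟨Real.exp B * (1 + (Nat.factorial 8 : ℝ)), by positivity, fun u hu => ?_⟩
  obtain ⟨v, hv, rfl⟩ : ∃ v : ℝ, 0 ≤ v ∧ v ^ 4 = u :=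
    ⟨u ^ ((4 : ℕ) : ℝ)⁻¹, by positivity, Real.rpow_inv_natCast_pow hu (by norm_num)⟩
  have h1 : √(v ^ 4) = v ^ 2 := by
    rw [show v ^ 4 = (v ^ 2) ^ 2 by ring, Real.sqrt_sq (by positivity)]
  have h2 : (v ^ 4) ^ (3 / 4 : ℝ) = v ^ 3 := by
    rw [← Real.rpow_natCast v 4, ← Real.rpow_mul hv, ← Real.rpow_natCast v 3]
    norm_num
  rw [h1, h2, le_div_iff₀ (by positivity)]
  have h3 : A * v ^ 2 - κ * v ^ 3 ≤ B - v := by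
    rcases le_total v v₀ with h | h
    · have h4 : v ^ 2 ≤ v₀ ^ 2 := by gcongr
      have h5 := mul_le_mul_of_nonneg_left h4 hA
      have h6 : 0 ≤ κ * v ^ 3 := by positivity
      simp only [B]
      linarith
    · have h4 : A + 1 ≤ κ * v := by
        have h5 : (A + 1) / κ ≤ v := by linarith
        rw [div_le_iff₀ hκ] at h5
        linarith
      have hv1 : 1 ≤ v := by
        have : 0 ≤ (A + 1) / κ := by positivity
        linarith
      have h5 : (A + 1) * v ^ 2 ≤ κ * v * v ^ 2 := by gcongr
      have h6 : v ≤ v ^ 2 := by nlinarith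
      have h7 : 0 ≤ B := by
        have : 0 ≤ v₀ := by positivity
        positivity
      nlinarith
  have h4 : 1 + (v ^ 4) ^ 2 ≤ (1 + (Nat.factorial 8 : ℝ)) * Real.exp v := by
    have h5 := Real.pow_div_factorial_le_exp v hv 8
    rw [div_le_iff₀ (by positivity)] at h5
    have h6 := Real.one_le_exp hv
    nlinarith
  calc Real.exp (A * v ^ 2 - κ * v ^ 3) * (1 + (v ^ 4) ^ 2)
      ≤ Real.exp (B - v) * ((1 + (Nat.factorial 8 : ℝ)) * Real.exp v) := by gcongr
    _ = Real.exp (B - v) * Real.exp v * (1 + (Nat.factorial 8 : ℝ)) := by ring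
    _ = _ := by rw [← Real.exp_add, sub_add_cancel]

theorem le_re_cpow {z : ℂ} (hz : 0 ≤ z.re) :
    Real.cos (3 * Real.pi / 8) * ‖z‖ ^ (3 / 4 : ℝ) ≤ ((1 + z) ^ ((3 / 4 : ℝ) : ℂ)).re := by
  have hz1 : 0 ≤ (1 + z).re := by
    simp
    linarith
  have harg := Complex.abs_arg_le_pi_div_two_iff.2 hz1
  rw [Complex.cpow_ofReal_re]
  have hpi := Real.pi_pos
  have hc : Real.cos (3 * Real.pi / 8) ≤ Real.cos ((1 + z).arg * (3 / 4)) := by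
    rw [← Real.cos_abs ((1 + z).arg * (3 / 4))]
    refine Real.cos_le_cos_of_nonneg_of_le_pi (abs_nonneg _) (by linarith) ?_
    rw [abs_mul, abs_of_pos (by norm_num : (0 : ℝ) < 3 / 4)]
    linarith
  have hc0 : 0 ≤ Real.cos (3 * Real.pi / 8) :=
    Real.cos_nonneg_of_neg_pi_div_two_le_of_le (by linarith) (by linarith)
  have hn : ‖z‖ ≤ ‖1 + z‖ := by
    refine (sq_le_sq₀ (norm_nonneg _) (norm_nonneg _)).1 ?_
    rw [← Complex.normSq_eq_norm_sq, ← Complex.normSq_eq_norm_sq, Complex.normSq_apply,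
      Complex.normSq_apply]
    simp
    nlinarith
  rw [mul_comm]
  gcongr

/-- A holomorphic function in the right half-plane with prescribed decay. -/
theorem exists_decaying {p : ℝ → ℝ} (hp_nonneg : ∀ s, 0 ≤ s → 0 ≤ p s)
    (hp_mono : MonotoneOn p (Ici 0)) (hp : vulIntegral p ≠ ⊤) :
    ∃ (F : ℂ → ℂ) (κ : ℝ), 0 < κ ∧ DifferentiableOn ℂ F {z | -(1 / 2) < z.re} ∧
      (∀ z : ℂ, 0 ≤ z.re → ‖F z‖ ≤ Real.exp (-(κ * ‖z‖ ^ (3 / 4 : ℝ)))) ∧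
      (∀ y : ℝ, ‖F (y * Complex.I)‖ ≤
        Real.exp (p 1) * Real.exp (-p (√|y|)) * Real.exp (-(κ * |y| ^ (3 / 4 : ℝ)))) ∧
      (F 0).re ≠ 0 := by
  set a : ℕ → ℝ := fun n => p (2 ^ (n + 1)) with ha_def
  have ha : ∀ n, 0 ≤ a n := fun n => hp_nonneg _ (by positivity)
  have hs : Summable fun n => a n / 4 ^ n := summable_dyadic hp_nonneg hp_mono hp
  have hnorm : ∀ z : ℂ, ‖Complex.exp (-(1 + z) ^ ((3 / 4 : ℝ) : ℂ) - majorant a z)‖ =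
      Real.exp (-((1 + z) ^ ((3 / 4 : ℝ) : ℂ)).re - (majorant a z).re) := fun z => by
    rw [Complex.norm_exp, Complex.sub_re, Complex.neg_re]
  refine ⟨fun z => Complex.exp (-(1 + z) ^ ((3 / 4 : ℝ) : ℂ) - majorant a z),
    Real.cos (3 * Real.pi / 8), ?_, ?_, fun z hz => ?_, fun y => ?_, ?_⟩
  · have hpi := Real.pi_pos
    exact Real.cos_pos_of_mem_Ioo ⟨by linarith, by linarith⟩
  · refine DifferentiableOn.cexp (DifferentiableOn.sub (DifferentiableOn.neg ?_)
      (differentiableOn_majorant ha hs))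
    refine DifferentiableOn.cpow_const (by fun_prop) fun z hz => Or.inl ?_
    have : -(1 / 2) < z.re := hz
    simp
    linarith
  · rw [hnorm]
    refine Real.exp_le_exp.2 ?_
    have h1 := le_re_cpow hz
    have h2 := re_majorant_nonneg ha hs hz
    linarith
  · have hz : 0 ≤ ((y : ℂ) * Complex.I).re := by simp
    rw [hnorm, ← Real.exp_add, ← Real.exp_add]
    refine Real.exp_le_exp.2 ?_
    have h1 := le_re_cpow hz
    have h2 : p (√|y|) ≤ p 1 + (majorant a (y * Complex.I)).re := by
      rcases lt_or_ge |y| 1 with hy | hy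
      · have h3 : p (√|y|) ≤ p 1 := hp_mono (Real.sqrt_nonneg _) (mem_Ici.2 zero_le_one)
          (Real.sqrt_le_one.2 hy.le)
        have h4 := re_majorant_nonneg ha hs hz
        linarith
      · obtain ⟨n, hn, hn1⟩ := exists_nat_pow_near hy (by norm_num : (1 : ℝ) < 4)
        have h3 := le_re_majorant ha hs hn
        have h4 : p (√|y|) ≤ a n := by
          refine hp_mono (Real.sqrt_nonneg _) (mem_Ici.2 (by positivity)) ?_
          rw [Real.sqrt_le_left (by positivity), ← pow_mul, mul_comm, pow_mul]
          norm_num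
          exact hn1.le
        have h5 := hp_nonneg 1 zero_le_one
        linarith
    have h3 : ‖(y : ℂ) * Complex.I‖ = |y| := by simp
    rw [h3] at h1
    linarith
  · have : majorant a 0 = 0 := by simp [majorant]
    simp only [this]
    simp [Complex.exp_re]

open Complex Filter in
/-- Cauchy's theorem for a half-plane. -/
theorem integral_imaginary_axis_eq_zero {H : ℂ → ℂ} (hc : ContinuousOn H {z | 0 ≤ z.re})
    (hd : DifferentiableOn ℂ H {z | 0 < z.re}) {M : ℝ}
    (hM : ∀ z : ℂ, 0 ≤ z.re → ‖H z‖ ≤ M / (1 + ‖z‖ ^ 2)) :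
    Integrable (fun y : ℝ => H (y * I)) ∧ ∫ y : ℝ, H (y * I) = 0 := by
  have hM0 : 0 ≤ M := by simpa using (norm_nonneg _).trans (hM 0 (by simp))
  have hcy : Continuous fun y : ℝ => H (y * I) :=
    hc.comp_continuous (by fun_prop) fun y => by simp
  have hint : Integrable (fun y : ℝ => H (y * I)) := by
    refine (integrable_inv_one_add_sq.const_mul M).mono' hcy.aestronglyMeasurable
      (Eventually.of_forall fun y => ?_)
    have := hM (y * I) (by simp)
    simpa [div_eq_mul_inv] using this
  refine ⟨hint, ?_⟩
  have hn : Tendsto (fun n : ℕ => (n : ℝ)) atTop atTop := tendsto_natCast_atTop_atTop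
  have h1 : Tendsto (fun n : ℕ => ∫ y in (-(n : ℝ))..n, H (y * I)) atTop
      (nhds (∫ y : ℝ, H (y * I))) :=
    intervalIntegral_tendsto_integral hint (tendsto_neg_atTop_atBot.comp hn) hn
  refine tendsto_nhds_unique h1 ?_
  have hbound : ∀ n : ℕ, ‖∫ y in (-(n : ℝ))..n, H (y * I)‖ ≤ 4 * M * (n / (1 + (n : ℝ) ^ 2)) := by
    intro n
    have hn0 : (0 : ℝ) ≤ n := Nat.cast_nonneg n
    have hrect := integral_boundary_rect_eq_zero_of_continuousOn_of_differentiableOn H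
      (⟨0, -n⟩ : ℂ) (⟨n, n⟩ : ℂ) (hc.mono fun z hz => by
        have h2 := hz.1
        rw [mem_preimage, uIcc_of_le hn0] at h2
        exact h2.1) (hd.mono fun z hz => by
        have h2 := hz.1
        rw [mem_preimage, min_eq_left hn0] at h2
        exact h2.1)
    have hle : ∀ z : ℂ, 0 ≤ z.re → (n : ℝ) ≤ ‖z‖ → ‖H z‖ ≤ M / (1 + (n : ℝ) ^ 2) :=
      fun z hz hzn => (hM z hz).trans (by gcongr)
    have hb1 : ‖∫ x : ℝ in (0 : ℝ)..n, H (x + ((-n : ℝ) : ℂ) * I)‖ ≤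
        M / (1 + (n : ℝ) ^ 2) * |(n : ℝ) - 0| := by
      refine intervalIntegral.norm_integral_le_of_norm_le_const fun x hx => ?_
      rw [uIoc_of_le hn0] at hx
      refine hle _ (by simpa using hx.1.le) (le_trans ?_ (abs_im_le_norm _))
      simp
    have hb2 : ‖∫ x : ℝ in (0 : ℝ)..n, H (x + ((n : ℝ) : ℂ) * I)‖ ≤
        M / (1 + (n : ℝ) ^ 2) * |(n : ℝ) - 0| := by
      refine intervalIntegral.norm_integral_le_of_norm_le_const fun x hx => ?_
      rw [uIoc_of_le hn0] at hx
      refine hle _ (by simpa using hx.1.le) (le_trans ?_ (abs_im_le_norm _))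
      simp
    have hb3 : ‖∫ y : ℝ in (-(n : ℝ))..n, H (((n : ℝ) : ℂ) + y * I)‖ ≤
        M / (1 + (n : ℝ) ^ 2) * |(n : ℝ) - -n| := by
      refine intervalIntegral.norm_integral_le_of_norm_le_const fun x hx => ?_
      refine hle _ (by simp) (le_trans ?_ (abs_re_le_norm _))
      simp
    have heq : I * ∫ y in (-(n : ℝ))..n, H (y * I) =
        (∫ x : ℝ in (0 : ℝ)..n, H (x + ((-n : ℝ) : ℂ) * I)) -
        (∫ x : ℝ in (0 : ℝ)..n, H (x + ((n : ℝ) : ℂ) * I)) +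
        I * ∫ y : ℝ in (-(n : ℝ))..n, H (((n : ℝ) : ℂ) + y * I) := by
      simp only [smul_eq_mul, ofReal_zero, zero_add] at hrect
      exact (sub_eq_zero.1 hrect).symm
    have h3 : ‖∫ y in (-(n : ℝ))..n, H (y * I)‖ = ‖I * ∫ y in (-(n : ℝ))..n, H (y * I)‖ := by
      simp
    rw [h3, heq]
    refine (norm_add_le _ _).trans ((add_le_add_left (norm_sub_le _ _) _).trans ?_)
    rw [norm_mul, norm_I, one_mul]
    rw [sub_zero, abs_of_nonneg hn0] at hb1 hb2
    rw [sub_neg_eq_add, abs_of_nonneg (by linarith)] at hb3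
    have h4 : 4 * M * ((n : ℝ) / (1 + (n : ℝ) ^ 2)) = M / (1 + (n : ℝ) ^ 2) * n +
        M / (1 + (n : ℝ) ^ 2) * n + M / (1 + (n : ℝ) ^ 2) * (n + n) := by ring
    rw [h4]
    exact add_le_add (add_le_add hb1 hb2) hb3
  refine squeeze_zero_norm hbound ?_
  have h5 : Tendsto (fun n : ℕ => 4 * M * (1 / (n : ℝ))) atTop (nhds 0) := by
    simpa using (tendsto_const_div_atTop_nhds_zero_nat (1 : ℝ)).const_mul (4 * M)
  refine squeeze_zero (fun n => by positivity) (fun n => ?_) h5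
  rcases Nat.eq_zero_or_pos n with rfl | hpos
  · simp
  · have : (0 : ℝ) < n := by exact_mod_cast hpos
    refine mul_le_mul_of_nonneg_left ?_ (by positivity)
    rw [div_le_div_iff₀ (by positivity) this]
    nlinarith

open Complex in
theorem norm_cos_le (z : ℂ) : ‖cos z‖ ≤ Real.exp ‖z‖ := by
  rw [Complex.cos, norm_div, Complex.norm_two, div_le_iff₀ two_pos]
  refine (norm_add_le _ _).trans ?_
  have h1 : ‖exp (z * I)‖ ≤ Real.exp ‖z‖ := by
    simpa using Complex.norm_exp_le_exp_norm (z * I)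
  have h2 : ‖exp (-z * I)‖ ≤ Real.exp ‖z‖ := by
    simpa using Complex.norm_exp_le_exp_norm (-z * I)
  linarith

open Complex in
/-- The boundary values of a sufficiently decaying function annihilate all `cosSqrt x`. -/
theorem integral_cosSqrt_mul_eq_zero {F : ℂ → ℂ} (hc : ContinuousOn F {z | 0 ≤ z.re})
    (hd : DifferentiableOn ℂ F {z | 0 < z.re}) (x : ℝ) {M : ℝ}
    (hF : ∀ z : ℂ, 0 ≤ z.re → Real.exp (|x| * √‖z‖) * ‖F z‖ ≤ M / (1 + ‖z‖ ^ 2)) :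
    Integrable (fun l : ℝ => cosSqrt x l * (F (-l * I)).re) ∧
      ∫ l : ℝ, cosSqrt x l * (F (-l * I)).re = 0 := by
  obtain ⟨e, he⟩ := IsAlgClosed.exists_pow_nat_eq I two_pos
  set r : ℂ → ℂ := fun z => z ^ (((2 : ℕ) : ℂ)⁻¹) with hr
  have hr2 : ∀ z, r z ^ 2 = z := fun z => Complex.cpow_nat_inv_pow z two_ne_zero
  have hrn : ∀ z, ‖e * r z‖ = √‖z‖ := fun z => by
    rw [eq_comm, Real.sqrt_eq_iff_eq_sq (norm_nonneg _) (norm_nonneg _), ← norm_pow, mul_pow, he,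
      hr2]
    simp
  have hrc : ContinuousOn r {z | 0 ≤ z.re} := fun z hz =>
    (continuousAt_cpow_const_of_re_pos (Or.inl hz) (by
      rw [← ofReal_natCast, ← ofReal_inv, ofReal_re]
      norm_num)).continuousWithinAt
  have hrd : DifferentiableOn ℂ r {z | 0 < z.re} :=
    DifferentiableOn.cpow_const differentiableOn_id fun z hz => Or.inl hz
  obtain ⟨hint, hzero⟩ := integral_imaginary_axis_eq_zero
    (H := fun z => cos (x * (e * r z)) * F z) (M := M)
    ((continuous_cos.comp_continuousOn
      (continuousOn_const.mul (continuousOn_const.mul hrc))).mul hc)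
    (((hrd.const_mul e).const_mul (x : ℂ)).ccos.mul hd) (fun z hz => by
      refine le_trans ?_ (hF z hz)
      rw [norm_mul]
      refine mul_le_mul_of_nonneg_right ((norm_cos_le _).trans ?_) (norm_nonneg _)
      rw [norm_mul, hrn, norm_real, Real.norm_eq_abs])
  have hpt : ∀ l : ℝ, cos (x * (e * r ((-l : ℝ) * I))) * F ((-l : ℝ) * I) =
      cosSqrt x l * F (-l * I) := by
    intro l
    have h1 : (e * r ((-l : ℝ) * I)) ^ 2 = root l ^ 2 := by
      rw [mul_pow, he, hr2, root_sq]
      push_cast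
      linear_combination (-(l : ℂ)) * I_sq
    rw [cosSqrt_eq, ofReal_neg]
    congr 1
    rcases sq_eq_sq_iff_eq_or_eq_neg.1 h1 with h2 | h2 <;> rw [ofReal_neg] at h2 <;> rw [h2]
    rw [mul_neg, cos_neg]
  have hint' := hint.comp_neg
  rw [← integral_neg_eq_self] at hzero
  simp only [hpt] at hint' hzero
  have hre : ∀ l : ℝ, ((cosSqrt x l : ℂ) * F (-l * I)).re = cosSqrt x l * (F (-l * I)).re :=
    fun l => re_ofReal_mul _ _
  have h3 := reCLM.integral_comp_comm hint'
  rw [hzero] at h3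
  simp only [reCLM_apply, hre, zero_re] at h3
  refine ⟨?_, h3⟩
  have h4 := hint'.re
  simpa [hre] using h4

section

variable {g : ℝ → ℝ}

theorem integral_withDensityᵥ (hg : Integrable g) (hgm : Measurable g) {f : ℝ → ℝ}
    (hfm : Measurable f) (hfg : Integrable fun l => f l * g l) :
    ∫ᵛ l, f l ∂•(volume.withDensityᵥ g) = ∫ l, f l * g l := by
  have hP := isFiniteMeasure_withDensity_ofReal hg.2
  have hN := isFiniteMeasure_withDensity_ofReal hg.neg.2
  have hfin : ∀ k : ℝ → ℝ, ∀ᵐ x : ℝ, ENNReal.ofReal (k x) < ⊤ := fun k =>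
    Filter.Eventually.of_forall fun x => ENNReal.ofReal_lt_top
  have hk : ∀ k : ℝ → ℝ, Measurable k → (∀ l, |k l| = |g l|) →
      Integrable f (volume.withDensity fun x => ENNReal.ofReal (k x)) ∧
      Integrable (fun l => (ENNReal.ofReal (k l)).toReal • f l) := by
    intro k hkm hkg
    have h1 : Integrable (fun l => (ENNReal.ofReal (k l)).toReal • f l) := by
      refine hfg.mono (hkm.ennreal_ofReal.ennreal_toReal.smul hfm).aestronglyMeasurable
        (Filter.Eventually.of_forall fun l => ?_)
      rw [norm_smul, norm_mul, mul_comm, ENNReal.toReal_ofReal']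
      refine mul_le_mul_of_nonneg_left ?_ (norm_nonneg _)
      rw [Real.norm_of_nonneg (le_max_right _ _), Real.norm_eq_abs, ← hkg]
      exact max_le (le_abs_self _) (abs_nonneg _)
    exact ⟨(integrable_withDensity_iff_integrable_smul' hkm.ennreal_ofReal (hfin k)).2 h1, h1⟩
  have h1 := hk g hgm fun l => rfl
  have h2 := hk (fun l => -g l) hgm.neg fun l => abs_neg _
  rw [withDensityᵥ_eq_withDensity_pos_part_sub_withDensity_neg_part hg,
    integral_sub_toSignedMeasure _ _ h1.1 h2.1,
    integral_withDensity_eq_integral_toReal_smul hgm.ennreal_ofReal (hfin g),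
    integral_withDensity_eq_integral_toReal_smul (f := fun l => ENNReal.ofReal (-g l))
      hgm.neg.ennreal_ofReal (hfin fun l => -g l),
    ← integral_sub h1.2 h2.2]
  refine integral_congr_ae (Filter.Eventually.of_forall fun l => ?_)
  simp only [ENNReal.toReal_ofReal', smul_eq_mul]
  rcases le_total 0 (g l) with h | h
  · rw [max_eq_left h, max_eq_right (neg_nonpos.2 h)]
    ring
  · rw [max_eq_right h, max_eq_left (neg_nonneg.2 h)]
    ring

theorem setIntegral_Iic_sub (hg : Integrable g) {a b : ℝ} (hab : a ≤ b) :
    (∫ t in Iic b, g t) - ∫ t in Iic a, g t = ∫ t in Ioc a b, g t := by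
  rw [intervalIntegral.integral_Iic_sub_Iic hg.integrableOn hg.integrableOn,
    intervalIntegral.integral_of_le hab]

theorem hasDerivAt_setIntegral_Iic (hg : Integrable g) (hgc : Continuous g) (x : ℝ) :
    HasDerivAt (fun x => ∫ t in Iic x, g t) (g x) x := by
  have h1 := (intervalIntegral.integral_hasDerivAt_right (a := 0) (b := x)
    hg.intervalIntegrable (hgc.stronglyMeasurableAtFilter _ _) hgc.continuousAt).const_add
    (∫ t in Iic (0 : ℝ), g t)
  refine h1.congr_of_eventuallyEq (Filter.Eventually.of_forall fun y => ?_)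
  simp only
  rw [← intervalIntegral.integral_Iic_sub_Iic hg.integrableOn hg.integrableOn]
  ring

theorem boundedVariationOn_setIntegral_Iic (hg : Integrable g) :
    BoundedVariationOn (fun x => ∫ t in Iic x, g t) univ := by
  refine ne_top_of_le_ne_top hg.2.ne (iSup_le ?_)
  rintro ⟨n, u, hu, -⟩
  calc ∑ i ∈ Finset.range n, edist (∫ t in Iic (u (i + 1)), g t) (∫ t in Iic (u i), g t)
      ≤ ∑ i ∈ Finset.range n, ∫⁻ t in Ioc (u i) (u (i + 1)), ‖g t‖ₑ := by
        refine Finset.sum_le_sum fun i _ => ?_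
        rw [edist_eq_enorm_sub, setIntegral_Iic_sub hg (hu (Nat.le_add_right i 1))]
        exact enorm_integral_le_lintegral_enorm _
    _ = ∫⁻ t in ⋃ i ∈ Finset.range n, Ioc (u i) (u (i + 1)), ‖g t‖ₑ := by
        exact (lintegral_biUnion_finset (fun i _ j _ hij => hu.pairwise_disjoint_on_Ioc_succ hij)
          (fun i _ => measurableSet_Ioc) _).symm
    _ ≤ ∫⁻ t, ‖g t‖ₑ := setLIntegral_le_lintegral _ _

theorem vectorMeasure_setIntegral_Iic (hg : Integrable g) (hgc : Continuous g) :
    (boundedVariationOn_setIntegral_Iic hg).vectorMeasure = volume.withDensityᵥ g := by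
  set hσ := boundedVariationOn_setIntegral_Iic hg
  have hIoc : ∀ a b : ℝ, a ≤ b → hσ.vectorMeasure (Ioc a b) = volume.withDensityᵥ g (Ioc a b) := by
    intro a b hab
    have hr : ∀ x, (fun x => ∫ t in Iic x, g t).rightLim x = ∫ t in Iic x, g t := fun x =>
      (hasDerivAt_setIntegral_Iic hg hgc x).continuousAt.continuousWithinAt.rightLim_eq
    rw [hσ.vectorMeasure_Ioc hab, hr, hr, withDensityᵥ_apply hg measurableSet_Ioc,
      setIntegral_Iic_sub hg hab]
  refine VectorMeasure.ext_of_generateFrom {S : Set ℝ | ∃ l u, l < u ∧ Ioc l u = S} ?_ ?_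
    (isPiSystem_Ioc id id) ?_
  · rintro _ ⟨a, b, hab, rfl⟩
    exact hIoc a b hab.le
  · rw [← borel_eq_generateFrom_Ioc, ← BorelSpace.measurable_eq (α := ℝ)]
  · have hU : (⋃ n : ℕ, Ioc (-(n : ℝ)) n) = univ := by
      refine eq_univ_of_forall fun x => ?_
      obtain ⟨n, hn⟩ := exists_nat_gt |x|
      exact mem_iUnion.2 ⟨n, (abs_lt.1 hn).1, (abs_lt.1 hn).2.le⟩
    have hmono : Monotone fun n : ℕ => Ioc (-(n : ℝ)) n := fun m n hmn =>
      Ioc_subset_Ioc (neg_le_neg (Nat.cast_le.2 hmn)) (Nat.cast_le.2 hmn)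
    have h1 := hσ.vectorMeasure.tendsto_vectorMeasure_iUnion_atTop_nat hmono
      fun n => measurableSet_Ioc
    have h2 := (volume.withDensityᵥ g).tendsto_vectorMeasure_iUnion_atTop_nat hmono
      fun n => measurableSet_Ioc
    rw [hU] at h1 h2
    refine tendsto_nhds_unique h1 (h2.congr fun n => (hIoc _ _ ?_).symm)
    have : (0 : ℝ) ≤ n := Nat.cast_nonneg n
    linarith

theorem growth_setIntegral_Iic (hg : Integrable g) (hgc : Continuous g) (x : ℝ) :
    growth (boundedVariationOn_setIntegral_Iic hg) x =
      ∫⁻ l in Iic (0 : ℝ), ENNReal.ofReal (|g l| * Real.exp (x * √|l|)) := by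
  rw [growth, vectorMeasure_setIntegral_Iic hg hgc, Measure.variation_withDensityᵥ hg,
    restrict_withDensity measurableSet_Iic,
    lintegral_withDensity_eq_lintegral_mul _ hgc.measurable.enorm (by fun_prop)]
  refine lintegral_congr fun l => ?_
  rw [Pi.mul_apply, Real.enorm_eq_ofReal_abs, ENNReal.ofReal_mul (abs_nonneg _)]

end

theorem le_exp_conjugate (p : ℝ → ℝ) {s : ℝ} (hs : 0 ≤ s) (x : ℝ) :
    ENNReal.ofReal (Real.exp (x * s - p s)) ≤ (conjugate p x).exp := by
  rw [← EReal.exp_coe]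
  exact EReal.exp_monotone (le_iSup₂ (f := fun s (_ : s ∈ Ici (0 : ℝ)) =>
    ((x * s - p s : ℝ) : EReal)) s hs)

theorem lintegral_const_div_one_add_sq_lt_top (M : ℝ) :
    ∫⁻ l : ℝ, ENNReal.ofReal (M / (1 + l ^ 2)) < ⊤ := by
  have : Integrable fun l : ℝ => M / (1 + l ^ 2) := by
    simpa [div_eq_mul_inv] using integrable_inv_one_add_sq.const_mul M
  exact this.lintegral_lt_top

theorem counterexample {p : ℝ → ℝ} (hp_nonneg : ∀ s, 0 ≤ s → 0 ≤ p s)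
    (hp_mono : MonotoneOn p (Ici 0)) (hp : vulIntegral p ≠ ⊤) :
    ∃ (σ : ℝ → ℝ) (hσ : BoundedVariationOn σ univ),
      (∀ l : ℝ, ContinuousWithinAt σ (Ici l) l) ∧
      (∀ x : ℝ, 0 ≤ x → growth hσ x < ⊤) ∧
      Majorized p hσ ∧
      (∀ x : ℝ, cosTransform hσ x = 0) ∧
      ¬ ∃ c : ℝ, ∀ l : ℝ, σ l = c := by
  obtain ⟨F, κ, hκ, hd, hF, hFp, hF0⟩ := exists_decaying hp_nonneg hp_mono hp
  have hcF : ContinuousOn F {z | 0 ≤ z.re} := hd.continuousOn.mono fun z hz => by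
    have : 0 ≤ z.re := hz
    simp only [mem_ofPred_eq]
    linarith
  have hdF : DifferentiableOn ℂ F {z | 0 < z.re} := hd.mono fun z hz => by
    have : 0 < z.re := hz
    simp only [mem_ofPred_eq]
    linarith
  have hFx : ∀ x : ℝ, ∃ M, 0 < M ∧ ∀ z : ℂ, 0 ≤ z.re →
      Real.exp (|x| * √‖z‖) * ‖F z‖ ≤ M / (1 + ‖z‖ ^ 2) := by
    intro x
    obtain ⟨M, hM0, hM⟩ := exp_sqrt_sub_le (abs_nonneg x) hκ
    refine ⟨M, hM0, fun z hz => le_trans ?_ (hM _ (norm_nonneg z))⟩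
    rw [sub_eq_add_neg, Real.exp_add]
    exact mul_le_mul_of_nonneg_left (hF z hz) (Real.exp_pos _).le
  have hcos : ∀ x : ℝ, Integrable (fun l : ℝ => cosSqrt x l * (F (-l * Complex.I)).re) ∧
      ∫ l : ℝ, cosSqrt x l * (F (-l * Complex.I)).re = 0 := fun x => by
    obtain ⟨M, -, hM⟩ := hFx x
    exact integral_cosSqrt_mul_eq_zero hcF hdF x hM
  set g : ℝ → ℝ := fun l => (F (-l * Complex.I)).re with hg_def
  have hgc : Continuous g := Complex.continuous_re.comp
    (hcF.comp_continuous (by fun_prop) fun y => by simp)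
  have hg : Integrable g := by
    have := (hcos 0).1
    simpa [cosSqrt, hg_def] using this
  have hgF : ∀ l : ℝ, |g l| ≤ ‖F (-l * Complex.I)‖ := fun l => Complex.abs_re_le_norm _
  have hnorm : ∀ l : ℝ, ‖(-l * Complex.I : ℂ)‖ = |l| := fun l => by simp
  refine ⟨fun x => ∫ t in Iic x, g t, boundedVariationOn_setIntegral_Iic hg, fun l =>
    (hasDerivAt_setIntegral_Iic hg hgc l).continuousAt.continuousWithinAt, fun x hx => ?_, ?_,
    fun x => ?_, ?_⟩
  · rw [growth_setIntegral_Iic hg hgc]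
    obtain ⟨M, hM0, hM⟩ := hFx x
    refine lt_of_le_of_lt ((setLIntegral_le_lintegral _ _).trans (lintegral_mono fun l => ?_))
      (lintegral_const_div_one_add_sq_lt_top M)
    refine ENNReal.ofReal_le_ofReal ?_
    have h1 := hM (-l * Complex.I) (by simp)
    rw [hnorm, abs_of_nonneg hx, sq_abs] at h1
    refine le_trans ?_ h1
    rw [mul_comm]
    exact mul_le_mul_of_nonneg_left (hgF l) (Real.exp_pos _).le
  · obtain ⟨M, hM0, hM⟩ := exp_sqrt_sub_le le_rfl hκ
    have hfin := lintegral_const_div_one_add_sq_lt_top (Real.exp (p 1) * M)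
    set J := ∫⁻ l : ℝ, ENNReal.ofReal (Real.exp (p 1) * M / (1 + l ^ 2)) with hJ
    refine ⟨J.toReal + 1, by positivity, fun x hx => ?_⟩
    rw [growth_setIntegral_Iic hg hgc]
    have hpt : ∀ l : ℝ, ENNReal.ofReal (|g l| * Real.exp (x * √|l|)) ≤
        ENNReal.ofReal (Real.exp (p 1) * M / (1 + l ^ 2)) * (conjugate p x).exp := by
      intro l
      refine le_trans ?_ (mul_le_mul_right (le_exp_conjugate p (Real.sqrt_nonneg |l|) x) _)
      rw [← ENNReal.ofReal_mul (by positivity)]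
      refine ENNReal.ofReal_le_ofReal ?_
      have h1 : |g l| ≤ Real.exp (p 1) * Real.exp (-p (√|l|)) *
          Real.exp (-(κ * |l| ^ (3 / 4 : ℝ))) := by
        have h2 := hFp (-l)
        rw [Complex.ofReal_neg, abs_neg] at h2
        exact (hgF l).trans h2
      have h3 : Real.exp (-(κ * |l| ^ (3 / 4 : ℝ))) ≤ M / (1 + l ^ 2) := by
        have h4 := hM |l| (abs_nonneg l)
        rwa [zero_mul, zero_sub, sq_abs] at h4
      have h5 : Real.exp (x * √|l| - p (√|l|)) = Real.exp (x * √|l|) * Real.exp (-p (√|l|)) := by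
        rw [← Real.exp_add, sub_eq_add_neg]
      rw [h5]
      calc |g l| * Real.exp (x * √|l|)
          ≤ (Real.exp (p 1) * Real.exp (-p (√|l|)) * (M / (1 + l ^ 2))) * Real.exp (x * √|l|) := by
            refine mul_le_mul_of_nonneg_right (h1.trans ?_) (Real.exp_pos _).le
            exact mul_le_mul_of_nonneg_left h3 (by positivity)
        _ = _ := by ring
    calc ∫⁻ l in Iic (0 : ℝ), ENNReal.ofReal (|g l| * Real.exp (x * √|l|))
        ≤ ∫⁻ l : ℝ, ENNReal.ofReal (Real.exp (p 1) * M / (1 + l ^ 2)) * (conjugate p x).exp :=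
          (setLIntegral_le_lintegral _ _).trans (lintegral_mono hpt)
      _ = J * (conjugate p x).exp := by
          rw [lintegral_mul_const _ (by fun_prop)]
      _ ≤ ENNReal.ofReal (J.toReal + 1) * (conjugate p x).exp := by
          gcongr
          rw [ENNReal.le_ofReal_iff_toReal_le hfin.ne (by positivity)]
          linarith
  · rw [cosTransform, vectorMeasure_setIntegral_Iic hg hgc,
      integral_withDensityᵥ (f := cosSqrt x) hg hgc.measurable
        (measurable_cosSqrt.comp (measurable_const.prodMk measurable_id)) (hcos x).1]
    exact (hcos x).2
  · rintro ⟨c, hc⟩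
    have h1 := hasDerivAt_setIntegral_Iic hg hgc 0
    rw [funext hc] at h1
    have h2 := h1.unique (hasDerivAt_const 0 c)
    refine hF0 ?_
    simpa [hg_def] using h2

end Vul

theorem theorem1 (p : ℝ → ℝ) (hp_nonneg : ∀ s, 0 ≤ s → 0 ≤ p s)
    (hp_mono : MonotoneOn p (Set.Ici 0)) (hp_conv : ConvexOn ℝ (Set.Ici 0) p) :
    (Vul.vulIntegral p = ⊤ →
      ∀ (σ : ℝ → ℝ) (hσ : BoundedVariationOn σ Set.univ),
        Vul.Majorized p hσ →
        (∀ x : ℝ, Vul.cosTransform hσ x = 0) →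
        ∃ c : ℝ, ∀ l : ℝ,
          (ContinuousWithinAt σ (Set.Ici l) l ∨ ContinuousWithinAt σ (Set.Iic l) l) → σ l = c) ∧
    (Vul.vulIntegral p ≠ ⊤ →
      ∃ (σ : ℝ → ℝ) (hσ : BoundedVariationOn σ Set.univ),
        (∀ l : ℝ, ContinuousWithinAt σ (Set.Ici l) l) ∧
        (∀ x : ℝ, 0 ≤ x → Vul.growth hσ x < ⊤) ∧
        Vul.Majorized p hσ ∧
        (∀ x : ℝ, Vul.cosTransform hσ x = 0) ∧
        ¬ ∃ c : ℝ, ∀ l : ℝ, σ l = c) :=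
  ⟨fun hp _ hσ hmaj hcos => Vul.uniqueness hp_nonneg hp_mono hp_conv hp hσ hmaj hcos,
    fun hp => Vul.counterexample hp_nonneg hp_mono hp⟩
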